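/- **Setting.** Let $d,n,k\ge 1$ be integers, $X\subseteq\mathbb R^d$, and let $f:\mathbb R^d\to[0,\infty)$ be a probability density that vanishes outside $X$; $\Lambda=\sup_X f\in(0,\infty]$. Let $v_d$ be the volume of the unit ball, $B(x,r)$ the closed Euclidean ball, and $Z_\sigma=Z+B(0,\sigma)$ for $Z\subseteq\mathbb R^d$, $\sigma>0$. A set is called connected if any two of its points are joined by a path in it. The supremum over the empty set is $-\infty$. *Algorithms.* Let $X_n=\{x_1,\dots,x_n\}$ be an i.i.d. sample from $f$ and let $r_k(x_i)=\min\{r: B(x_i,r)\text{ contains } k \text{ data points}\}$ ($x_i$ included). For $0\le r\le\infty$ the level-$r$ graph has nodes $\{x_i: r_k(x_i)\le r\}$ and an edge between nodes $x_i\ne x_j$ iff $\|x_i-x_j\|\le\alpha r$ (Algorithm 1), respectively iff $\|x_i-x_j\|\le\alpha\min(r_k(x_i),r_k(x_j))$ or, in its other variant, $\|x_i-x_j\|\le\alpha\max(r_k(x_i),r_k(x_j))$ (Algorithm 2). *Pruning.* Let $C_\delta=2C_o\log(2/\delta)$. For $\lambda>0$ let $r(\lambda)$ be the $r$ with $v_dr^d\lambda=\frac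 kn+\frac{C_\delta}{n}\sqrt{kd\log n}$, and $r(0)=\infty$. Pruning of level $r$ with parameter $\tilde\epsilon$: put $\tilde\lambda_r=\frac1{v_dr^d}\big(\frac kn-\frac{C_\delta}{n}\sqrt{kd\log n}\big)-\tilde\epsilon$, and connect any two components of the level-$r$ graph that lie in the same connected component of the (unpruned) graph of level $r(\max(\tilde\lambda_r,0))$. Let $\mathbb C_n(r)$ be the set of components at level $r$ after pruning. **Theorem.** There are absolute constants $C_o,C>0$ such that the following holds for all $d,n,k,X,f$ as above. Let $0<\delta,\epsilon<1$ and $\tilde\epsilon>0$. Run Algorithm 1 or 2 with $$\sqrt2\le\alpha\le2,\qquad k\ \ge\ C\cdot\frac{d\log n}{\epsilon^2}\cdot\log^2\frac2\delta ,$$ followed by pruning with parameter $\tilde\epsilon$. Then with probability at least $1-\delta$ both statements below hold for every $\sigma>0$, where $$\lambda_o=\frac{k}{nv_d(\sigma/2)^d}\cdot\frac{1+\epsilon}{1-\epsilon}+\frac{\tilde\epsilon}{1-\epsilon},$$ or, for Algorithm 2, the maximum of this quantity and $\frac{\Lambda}{k}\,C\,d\log n\cdot\log\frac2\delta$. (i)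 *Recovery of true clusters.* Let $A,A'\subseteq X$ be any two sets with $\lambda=\inf_{A_\sigma\cup A'_\sigma}f\ge\lambda_o$, and suppose that there is a set $S$ such that any path in the convex hull of $X$ (that is, in $X$ itself when $X$ is convex) from $A$ to $A'$ intersects $S$, and $\sup_{S_\sigma}f<(1-2\epsilon)\lambda-\tilde\epsilon$. Then all points of $(A\cup A')\cap X_n$ are present in $\mathbb C_n(r(\lambda))$; no component in $\mathbb C_n(r(\lambda))$ contains both a point of $A\cap X_n$ and a point of $A'\cap X_n$; if $A$ is connected, then $A\cap X_n$ lies in a single component in $\mathbb C_n(r(\lambda))$, and likewise for $A'$. In particular, if $A,A'$ are connected, $A\cap X_n$ and $A'\cap X_n$ are individually connected in $\mathbb C_n(r(\lambda))$ but lie in two separate components. (ii) *Removal of false clusters.* Assume $\tilde\epsilon\ge2\sup_{x,x'\in\mathbb R^d,\ \|x-x'\|\le\sigma}|f(x)-f(x')|$. Let $A_n,A_n'$ be the vertex sets of two disjoint components in $\mathbb C_n(r)$, for any $r\in(0,\infty)$. If $\lambda=\inf_{A_n\cup A_n'}f\ge\lambda_o$, then $A_n$ and $A_n'$ are disconnected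 in the level set $\{x\in X:f(x)\ge\lambda\}$: no path in it joins a point of $A_n$ to a point of $A_n'$. -/

import Mathlib

open MeasureTheory
open scoped ENNReal

noncomputable section

namespace ClusterTree

/-- `ℝ^d` with the Euclidean norm. -/
abbrev Space (d : ℕ) := EuclideanSpace ℝ (Fin d)

/-- The volume `v_d` of the unit ball of `ℝ^d`. -/
def unitBallVolume (d : ℕ) : ℝ := (volume (Metric.closedBall (0 : Space d) 1)).toReal

/-- `f` is a probability density on `ℝ^d` supported on `X`: it vanishes outside `X`
(and possibly at some points of `X` too). -/
structure IsDensityOn {d : ℕ} (X : Set (Space d)) (f : Space d → ℝ) : Prop where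
  measurable : Measurable f
  nonneg : ∀ x, 0 ≤ f x
  eq_zero_of_notMem : ∀ x, x ∉ X → f x = 0
  lintegral_eq_one : ∫⁻ x, ENNReal.ofReal (f x) = 1

/-- The law of one observation. -/
def densityMeasure {d : ℕ} (f : Space d → ℝ) : Measure (Space d) :=
  volume.withDensity fun x => ENNReal.ofReal (f x)

/-- The law of an i.i.d. sample of size `n` drawn from `f`. -/
def sampleMeasure {d : ℕ} (f : Space d → ℝ) (n : ℕ) : Measure (Fin n → Space d) :=
  Measure.pi fun _ => densityMeasure f

open scoped Pointwise in
/-- The buffered set `Z_σ = Z + B(0, σ)`, with `B(0, σ)` the closed ball. -/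
def buffer {d : ℕ} (Z : Set (Space d)) (σ : ℝ) : Set (Space d) :=
  Z + Metric.closedBall 0 σ

/-- The supremum of `f` over `Z`, as an extended real (`⊥` if `Z` is empty, `⊤` if `f` is not
bounded above on `Z`). -/
def supOn {d : ℕ} (f : Space d → ℝ) (Z : Set (Space d)) : EReal :=
  ⨆ x ∈ Z, (f x : EReal)

/-- `sup_{‖x - x'‖ ≤ σ} |f x - f x'|`, over all pairs of points of `ℝ^d`. -/
def oscillation {d : ℕ} (f : Space d → ℝ) (σ : ℝ) : EReal :=
  ⨆ (x : Space d) (x' : Space d) (_ : ‖x - x'‖ ≤ σ), ((|f x - f x'| : ℝ) : EReal)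

/-! ### The two cluster tree algorithms -/

/-- Algorithm 1 (robust single linkage), and Algorithm 2 with either of its two edge rules. -/
inductive Algorithm
  | linkage
  | mutualNearestNeighbor
  | nearestNeighbor

/-- `r_k(x_i) = min {r : B(x_i, r) contains k data points}` (`x_i` itself counts); it is `∞` if
there are fewer than `k` data points. -/
def knnRadius {d n : ℕ} (k : ℕ) (x : Fin n → Space d) (i : Fin n) : ℝ≥0∞ :=
  sInf {r : ℝ≥0∞ | k ≤ Set.ncard {j : Fin n | edist (x j) (x i) ≤ r}}

/-- The nodes of the graph at level `r ∈ [0, ∞]`. -/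
def nodes {d n : ℕ} (k : ℕ) (x : Fin n → Space d) (r : ℝ≥0∞) : Set (Fin n) :=
  {i | knnRadius k x i ≤ r}

/-- Two nodes at level `r` are joined by an edge if their distance is at most `α` times this. -/
def edgeScale {d n : ℕ} (alg : Algorithm) (k : ℕ) (x : Fin n → Space d) (r : ℝ≥0∞)
    (i j : Fin n) : ℝ≥0∞ :=
  match alg with
  | .linkage => r
  | .mutualNearestNeighbor => min (knnRadius k x i) (knnRadius k x j)
  | .nearestNeighbor => max (knnRadius k x i) (knnRadius k x j)

theorem edgeScale_comm {d n : ℕ} (alg : Algorithm) (k : ℕ) (x : Fin n → Space d) (r : ℝ≥0∞)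
    (i j : Fin n) : edgeScale alg k x r i j = edgeScale alg k x r j i := by
  cases alg
  · rfl
  · exact min_comm _ _
  · exact max_comm _ _

/-- The graph at level `r`, as a graph on all indices: its nodes are `nodes k x r`, and the
other indices are isolated and ignored. -/
def levelGraph {d n : ℕ} (alg : Algorithm) (α : ℝ) (k : ℕ) (x : Fin n → Space d) (r : ℝ≥0∞) :
    SimpleGraph (Fin n) where
  Adj i j := i ≠ j ∧ i ∈ nodes k x r ∧ j ∈ nodes k x r ∧
    edist (x i) (x j) ≤ ENNReal.ofReal α * edgeScale alg k x r i j
  symm := ⟨fun i j h =>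
    ⟨h.1.symm, h.2.2.1, h.2.1, by rw [edist_comm, edgeScale_comm]; exact h.2.2.2⟩⟩
  loopless := ⟨fun _ h => h.1 rfl⟩

/-! ### Pruning -/

/-- The constant `C_δ = 2 C_o log (2 / δ)`. -/
def confidenceConst (C₀ δ : ℝ) : ℝ := 2 * C₀ * Real.log (2 / δ)

/-- `(C_δ / n) √(k d log n)`, with `Cδ` in the role of `C_δ`. -/
def deviation (Cδ : ℝ) (d n k : ℕ) : ℝ := Cδ / n * √(k * d * Real.log n)

/-- `r(lam)`: the solution `r` of `v_d r ^ d lam = k / n + (C_δ / n) √(k d log n)`. It is `∞`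
for `lam = 0`. -/
def levelRadius (Cδ : ℝ) (d n k : ℕ) (lam : ℝ) : ℝ≥0∞ :=
  (ENNReal.ofReal (k / n + deviation Cδ d n k) /
    ENNReal.ofReal (unitBallVolume d * lam)) ^ (1 / d : ℝ)

/-- `(1 / (v_d r ^ d)) (k / n - (C_δ / n) √(k d log n)) - ε'`, with `ε'` the pruning parameter. -/
def lookupDensity (Cδ ε' : ℝ) (d n k : ℕ) (r : ℝ≥0∞) : ℝ :=
  1 / (unitBallVolume d * r.toReal ^ d) * (k / n - deviation Cδ d n k) - ε'

/-- The level that the pruning procedure looks up when it prunes level `r`. -/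
def lookupRadius (Cδ ε' : ℝ) (d n k : ℕ) (r : ℝ≥0∞) : ℝ≥0∞ :=
  levelRadius Cδ d n k (max (lookupDensity Cδ ε' d n k r) 0)

/-- The graph at level `r` after pruning, again with set of nodes `nodes k x r`: nodes that are
in the same connected component at the looked up level get connected. -/
def prunedGraph {d n : ℕ} (alg : Algorithm) (α : ℝ) (k : ℕ) (Cδ ε' : ℝ) (x : Fin n → Space d)
    (r : ℝ≥0∞) : SimpleGraph (Fin n) where
  Adj i j := i ≠ j ∧ i ∈ nodes k x r ∧ j ∈ nodes k x r ∧
    ((levelGraph alg α k x r).Adj i j ∨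
      (levelGraph alg α k x (lookupRadius Cδ ε' d n k r)).Reachable i j)
  symm := ⟨fun _ _ h => ⟨h.1.symm, h.2.2.1, h.2.1, h.2.2.2.imp (fun e => e.symm)
    (fun e => e.symm)⟩⟩
  loopless := ⟨fun _ h => h.1 rfl⟩

/-- `T` is (the set of nodes of) a connected component of the pruned tree at level `r`. -/
def IsPrunedCluster {d n : ℕ} (alg : Algorithm) (α : ℝ) (k : ℕ) (Cδ ε' : ℝ)
    (x : Fin n → Space d) (r : ℝ≥0∞) (T : Set (Fin n)) : Prop :=
  ∃ i ∈ nodes k x r,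
    T = {j | j ∈ nodes k x r ∧ (prunedGraph alg α k Cδ ε' x r).Reachable i j}

/-- The data points in `A` all lie in a single connected component of the pruned tree at
level `r`. -/
def SampleConnected {d n : ℕ} (alg : Algorithm) (α : ℝ) (k : ℕ) (Cδ ε' : ℝ)
    (x : Fin n → Space d) (r : ℝ≥0∞) (A : Set (Space d)) : Prop :=
  ∀ i j, x i ∈ A → x j ∈ A → i ∈ nodes k x r ∧ j ∈ nodes k x r ∧
    (prunedGraph alg α k Cδ ε' x r).Reachable i j

/-- The data points in `A` and in `A'` are all present in the pruned tree at level `r`, and no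
connected component there contains a data point of `A` and one of `A'`. -/
def SampleSeparated {d n : ℕ} (alg : Algorithm) (α : ℝ) (k : ℕ) (Cδ ε' : ℝ)
    (x : Fin n → Space d) (r : ℝ≥0∞) (A A' : Set (Space d)) : Prop :=
  (∀ i, x i ∈ A ∪ A' → i ∈ nodes k x r) ∧
    ∀ i j, x i ∈ A → x j ∈ A' → ¬ (prunedGraph alg α k Cδ ε' x r).Reachable i j

/-! ### The two guarantees -/

/-- The density threshold `λ_o`. -/
def densityThreshold {d : ℕ} (alg : Algorithm) (X : Set (Space d)) (f : Space d → ℝ)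
    (C δ ε ε' σ : ℝ) (n k : ℕ) : EReal :=
  let base : ℝ :=
    k / (n * unitBallVolume d * (σ / 2) ^ d) * ((1 + ε) / (1 - ε)) + ε' / (1 - ε)
  match alg with
  | .linkage => (base : EReal)
  | _ => max (base : EReal)
      (supOn f X * ((C * d * Real.log n * Real.log (2 / δ) / k : ℝ) : EReal))

/-- Every path from `A` to `A'` in `K` meets `S`. -/
def Separates {d : ℕ} (K S A A' : Set (Space d)) : Prop :=
  ∀ a ∈ A, ∀ a' ∈ A', ∀ γ : Path a a', (∀ t, γ t ∈ K) → ∃ t, γ t ∈ S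

/-- Recovery of true clusters, for the sample `x` and the buffer width `σ`. -/
def RecoversTrueClusters {d n : ℕ} (alg : Algorithm) (X : Set (Space d)) (f : Space d → ℝ)
    (C Cδ δ ε ε' α : ℝ) (k : ℕ) (σ : ℝ) (x : Fin n → Space d) : Prop :=
  ∀ (A A' : Set (Space d)) (lam : ℝ), A ⊆ X → A' ⊆ X →
    lam = sInf (f '' (buffer A σ ∪ buffer A' σ)) →
    densityThreshold alg X f C δ ε ε' σ n k ≤ (lam : EReal) →
    (∃ S : Set (Space d), Separates (convexHull ℝ X) S A A' ∧
      supOn f (buffer S σ) < (((1 - 2 * ε) * lam - ε' : ℝ) : EReal)) →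
    (IsPathConnected A →
      SampleConnected alg α k Cδ ε' x (levelRadius Cδ d n k lam) A) ∧
    (IsPathConnected A' →
      SampleConnected alg α k Cδ ε' x (levelRadius Cδ d n k lam) A') ∧
    SampleSeparated alg α k Cδ ε' x (levelRadius Cδ d n k lam) A A'

/-- Removal of false clusters, for the sample `x` and the scale `σ`. -/
def RemovesFalseClusters {d n : ℕ} (alg : Algorithm) (X : Set (Space d)) (f : Space d → ℝ)
    (C Cδ δ ε ε' α : ℝ) (k : ℕ) (σ : ℝ) (x : Fin n → Space d) : Prop :=
  2 * oscillation f σ ≤ (ε' : EReal) →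
  ∀ (r : ℝ) (T T' : Set (Fin n)) (lam : ℝ), 0 < r →
    IsPrunedCluster alg α k Cδ ε' x (ENNReal.ofReal r) T →
    IsPrunedCluster alg α k Cδ ε' x (ENNReal.ofReal r) T' →
    Disjoint T T' →
    lam = sInf ((fun i => f (x i)) '' (T ∪ T')) →
    densityThreshold alg X f C δ ε ε' σ n k ≤ (lam : EReal) →
    ∀ i ∈ T, ∀ j ∈ T', ¬ JoinedIn {y | y ∈ X ∧ lam ≤ f y} (x i) (x j)

end ClusterTree

end

noncomputable section

namespace ClusterTree

/-! ### A Chernoff bound for the number of sample points related to a given one -/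

/-! All randomness is confined to one event, `IsTypicalSample`, of probability at least `1 - δ`; on
it both guarantees are deterministic, for all `σ`, `A`, `A'`, `S` and `r` at once.

Two uniform statements make up that event. The first concerns balls centred at data points. Around
one centre balls are nested, so uniformity in the radius is free: it suffices to count the points `x
j` for which the ball reaching from `x i` to `x j` has mass below a given level. Given `x i` this
count is binomial, a Chernoff bound applies, and a union over the `n` centres costs only `log n`.
The second, `HitsHalfBalls`, concerns half-balls with arbitrary centre, direction and scale, where
the density is large enough. Since neither `X` nor `f` need be bounded, the net is a packing by
boxes under the graph of `f`: that region has volume one, so disjoint boxes of volume bounded below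
are finitely many.

Connectedness (`IsTypicalSample.reachable`) follows a path in `A` by a chain of data points. When
the path point moves a little, translate the current data point along with it; the half-ball around
the new path point that faces the translate contains a data point, and by Pythagoras the step has
length at most `√2` times the radius. This is the role of `√2 ≤ α`.

Separation (`IsTypicalSample.not_reachable`): as `α ≤ 2`, a chain at level `R` stays within `R` of
its nodes. If it meets `S`, some node has its `R`-ball inside `S_σ`, where there is too little mass
for `k` points. Pruning merges only within components at the looked up level, so the argument is run
there.

Removal: two points joined inside a level set are joined by a chain at the slightly lower density
`lam - ε' / 2`, and pruning looks at a density no larger than that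
(`IsTypicalSample.lookupDensity_le`), so it has already merged them. -/

theorem measureReal_pi_le_exp {Ω : Type*} [MeasurableSpace Ω] (ν : Measure Ω)
    [IsProbabilityMeasure ν] (m : ℕ) (S : Set Ω) (hS : MeasurableSet S) (s B a : ℝ)
    (hB : ν.real S * (Real.exp s - 1) ≤ B) :
    (Measure.pi fun _ : Fin m => ν).real
      {y | a ≤ s * ∑ j, S.indicator (fun _ => (1 : ℝ)) (y j)} ≤ Real.exp (m * B - a) := by
  classical
  set g : Ω → ℝ := fun y => Real.exp (s * S.indicator (fun _ => (1 : ℝ)) y) with hg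
  have hgeq : ∀ y, g y = S.indicator (fun _ => Real.exp s - 1) y + 1 := by
    intro y
    by_cases hy : y ∈ S <;> simp [hg, hy]
  have hgint : Integrable g ν := by
    rw [show g = fun y => S.indicator (fun _ => Real.exp s - 1) y + 1 from funext hgeq]
    exact ((integrable_const _).indicator hS).add (integrable_const _)
  have hgi : ∫ y, g y ∂ν = ν.real S * (Real.exp s - 1) + 1 := by
    simp_rw [hgeq]
    rw [integral_add ((integrable_const _).indicator hS) (integrable_const _),
      integral_indicator hS]
    simp
  have hprod : ∀ y : Fin m → Ω,
      Real.exp (1 * (s * ∑ j, S.indicator (fun _ => (1 : ℝ)) (y j))) = ∏ j, g (y j) := by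
    intro y
    rw [one_mul, Finset.mul_sum, Real.exp_sum]
  have hint : Integrable (fun y : Fin m → Ω =>
      Real.exp (1 * (s * ∑ j, S.indicator (fun _ => (1 : ℝ)) (y j))))
      (Measure.pi fun _ : Fin m => ν) := by
    simp_rw [hprod]
    exact Integrable.fintype_prod fun _ => hgint
  have h := ProbabilityTheory.measure_ge_le_exp_mul_mgf (μ := Measure.pi fun _ : Fin m => ν) a
    (zero_le_one' ℝ) hint
  refine h.trans ?_
  have hm : ProbabilityTheory.mgf (fun y : Fin m → Ω =>
      s * ∑ j, S.indicator (fun _ => (1 : ℝ)) (y j)) (Measure.pi fun _ : Fin m => ν) 1 =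
      (ν.real S * (Real.exp s - 1) + 1) ^ m := by
    rw [ProbabilityTheory.mgf]
    simp_rw [hprod]
    rw [integral_fintype_prod_eq_prod (fun _ => g)]
    simp [hgi]
  rw [hm, show m * B - a = -a + m * B by ring, Real.exp_add, Real.exp_nat_mul]
  have h0 : 0 ≤ ν.real S * (Real.exp s - 1) + 1 := by
    rw [← hgi]; exact integral_nonneg fun _ => (Real.exp_pos _).le
  have h1 : ν.real S * (Real.exp s - 1) + 1 ≤ Real.exp B :=
    (Real.add_one_le_exp _).trans (Real.exp_le_exp.2 hB)
  rw [neg_one_mul]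
  gcongr

/-- Fubini: with coordinate `i` frozen at `c` the remaining `m` coordinates are still i.i.d., and
the one-set bound holds uniformly in `c`. The parameter `s` may have either sign, so this serves
both tails. -/
theorem measureReal_pi_pair_le_exp {Ω : Type*} [MeasurableSpace Ω] (ν : Measure Ω)
    [IsProbabilityMeasure ν] (m : ℕ) (i : Fin (m + 1)) (S : Set (Ω × Ω)) (hS : MeasurableSet S)
    (s B a : ℝ) (hB : ∀ c, ν.real {y | (c, y) ∈ S} * (Real.exp s - 1) ≤ B) :
    (Measure.pi fun _ : Fin (m + 1) => ν).real
      {x | a ≤ s * ∑ j : Fin m, S.indicator (fun _ => (1 : ℝ)) (x i, x (i.succAbove j))} ≤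
        Real.exp (m * B - a) := by
  have hind : Measurable (S.indicator fun _ => (1 : ℝ)) := measurable_const.indicator hS
  set T : Set (Ω × (Fin m → Ω)) :=
    {p | a ≤ s * ∑ j : Fin m, S.indicator (fun _ => (1 : ℝ)) (p.1, p.2 j)} with hT
  have hTm : MeasurableSet T := by
    refine measurableSet_le measurable_const (Measurable.const_mul ?_ _)
    refine Finset.measurable_fun_sum _ fun j _ => hind.comp ?_
    exact measurable_fst.prodMk ((measurable_pi_apply j).comp measurable_snd)
  have hmp := measurePreserving_piFinSuccAbove (fun _ : Fin (m + 1) => ν) i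
  have heq : {x : Fin (m + 1) → Ω |
      a ≤ s * ∑ j : Fin m, S.indicator (fun _ => (1 : ℝ)) (x i, x (i.succAbove j))} =
      MeasurableEquiv.piFinSuccAbove (fun _ => Ω) i ⁻¹' T := by
    ext x; rfl
  rw [heq, measureReal_def, hmp.measure_preimage hTm.nullMeasurableSet,
    Measure.prod_apply hTm]
  refine ENNReal.toReal_le_of_le_ofReal (Real.exp_pos _).le ?_
  calc ∫⁻ c, (Measure.pi fun _ : Fin m => ν) (Prod.mk c ⁻¹' T) ∂ν
      ≤ ∫⁻ _, ENNReal.ofReal (Real.exp (m * B - a)) ∂ν := by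
        refine lintegral_mono fun c => ?_
        have := measureReal_pi_le_exp ν m {y | (c, y) ∈ S} (measurable_prodMk_left hS) s B a (hB c)
        rw [measureReal_def] at this
        exact (ENNReal.le_ofReal_iff_toReal_le (measure_ne_top _ _) (Real.exp_pos _).le).2 this
    _ = ENNReal.ofReal (Real.exp (m * B - a)) := by simp

/-! ### The mass of the ball centred at one point and reaching to another -/

/-- The mass of the closed ball centred at `p.1` with `p.2` on its boundary. -/
def reachMass {d : ℕ} (ν : Measure (Space d)) (p : Space d × Space d) : ℝ :=
  ν.real (Metric.closedBall p.1 (dist p.2 p.1))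

theorem measurable_reachMass {d : ℕ} (ν : Measure (Space d)) [IsProbabilityMeasure ν] :
    Measurable (reachMass ν) := by
  have hs : MeasurableSet {q : (Space d × Space d) × Space d | dist q.2 q.1.1 ≤ dist q.1.2 q.1.1} :=
    (isClosed_le (by fun_prop) (by fun_prop)).measurableSet
  exact (measurable_measure_prodMk_left (ν := ν) hs).ennreal_toReal

/-- The set is a closed ball of mass at most `p`, or an increasing union of subsets of such balls,
and continuity from below gives the bound. If the admissible radii are unbounded, the union is the
whole space. No absolute continuity is needed on this side. -/
theorem measureReal_reachMass_le {d : ℕ} (ν : Measure (Space d)) [IsProbabilityMeasure ν]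
    (c : Space d) {p : ℝ} (hp : 0 ≤ p) : ν.real {y | reachMass ν (c, y) ≤ p} ≤ p := by
  set T : Set ℝ := {ρ | ν.real (Metric.closedBall c ρ) ≤ p ∧ 0 ≤ ρ} with hT
  have hsub : {y | reachMass ν (c, y) ≤ p} = {y | dist y c ∈ T} := by
    ext y; simp [hT, reachMass]
  rw [hsub]
  rcases T.eq_empty_or_nonempty with h | hne
  · simpa [h] using hp
  by_cases hbd : BddAbove T
  · obtain ⟨u, hum, hut, huT⟩ := exists_seq_tendsto_sSup hne hbd
    by_cases hmem : sSup T ∈ T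
    · refine le_trans (measureReal_mono ?_) hmem.1
      intro y hy
      exact le_csSup hbd hy
    · have hle : {y | dist y c ∈ T} ⊆ ⋃ j, Metric.closedBall c (u j) := by
        intro y hy
        have hlt : dist y c < sSup T := lt_of_le_of_ne (le_csSup hbd hy) fun h => hmem (h ▸ hy)
        obtain ⟨j, hj⟩ := (hut.eventually (lt_mem_nhds hlt)).exists
        exact Set.mem_iUnion.2 ⟨j, Metric.mem_closedBall.2 hj.le⟩
      refine (measureReal_mono hle).trans ?_
      have hmono : Monotone fun j => Metric.closedBall c (u j) :=
        fun a b hab => Metric.closedBall_subset_closedBall (hum hab)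
      have ht := tendsto_measure_iUnion_atTop (μ := ν) hmono
      have ht' := (ENNReal.tendsto_toReal (measure_ne_top ν _)).comp ht
      exact le_of_tendsto ht' (Filter.Eventually.of_forall fun j => (huT j).1)
  · have hle : (Set.univ : Set (Space d)) ⊆ ⋃ j : ℕ, Metric.closedBall c (j : ℝ) := by
      rw [Metric.iUnion_closedBall_nat]
    refine (measureReal_mono (Set.subset_univ _)).trans ?_
    rw [← Metric.iUnion_closedBall_nat c]
    have hmono : Monotone fun j : ℕ => Metric.closedBall c (j : ℝ) :=
      fun a b hab => Metric.closedBall_subset_closedBall (by exact_mod_cast hab)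
    have ht := tendsto_measure_iUnion_atTop (μ := ν) hmono
    have ht' := (ENNReal.tendsto_toReal (measure_ne_top ν _)).comp ht
    refine le_of_tendsto ht' (Filter.Eventually.of_forall fun j => ?_)
    obtain ⟨ρ, hρ, hj⟩ := not_bddAbove_iff.1 hbd j
    exact (measureReal_mono (Metric.closedBall_subset_closedBall hj.le)).trans hρ.1

/-- The smallest closed ball around `c` of mass at least `p` exists by continuity from above. Its
interior lies in the set, and its boundary sphere is null by absolute continuity. -/
theorem le_measureReal_reachMass_lt {d : ℕ} (hd : 1 ≤ d) (ν : Measure (Space d))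
    [IsProbabilityMeasure ν] (hac : ν ≪ volume) (c : Space d) {p : ℝ} (hp1 : p ≤ 1) :
    p ≤ ν.real {y | reachMass ν (c, y) < p} := by
  have : Nonempty (Fin d) := ⟨⟨0, hd⟩⟩
  set T : Set ℝ := {ρ | p ≤ ν.real (Metric.closedBall c ρ) ∧ 0 ≤ ρ} with hT
  have hsub : {y | reachMass ν (c, y) < p} = {y | dist y c ∉ T} := by
    ext y; simp [hT, reachMass]
  rw [hsub]
  rcases T.eq_empty_or_nonempty with h | hne
  · simpa [h] using hp1
  have hbd : BddBelow T := ⟨0, fun ρ h => h.2⟩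
  set R := sInf T with hR
  obtain ⟨u, hum, hut, huT⟩ := exists_seq_tendsto_sInf hne hbd
  have hball : p ≤ ν.real (Metric.closedBall c R) := by
    have hset : ⋂ j, Metric.closedBall c (u j) = Metric.closedBall c R := by
      ext y
      simp only [Set.mem_iInter, Metric.mem_closedBall]
      exact ⟨fun h => ge_of_tendsto' hut h, fun h j => h.trans (csInf_le hbd (huT j))⟩
    have ht := tendsto_measure_iInter_atTop (μ := ν) (s := fun j => Metric.closedBall c (u j))
      (fun j => Metric.isClosed_closedBall.measurableSet.nullMeasurableSet)
      (fun a b hab => Metric.closedBall_subset_closedBall (hum hab)) ⟨0, measure_ne_top _ _⟩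
    rw [hset] at ht
    have ht' := (ENNReal.tendsto_toReal (measure_ne_top ν _)).comp ht
    exact ge_of_tendsto ht' (Filter.Eventually.of_forall fun j => (huT j).1)
  have hsph : ν (Metric.sphere c R) = 0 := hac (Measure.addHaar_sphere volume c R)
  refine hball.trans ?_
  rw [← Metric.ball_union_sphere]
  refine (measureReal_union_le _ _).trans ?_
  rw [measureReal_def ν (Metric.sphere c R), hsph, ENNReal.toReal_zero, add_zero]
  refine measureReal_mono fun y hy => ?_
  exact notMem_of_lt_csInf (Metric.mem_ball.1 hy) hbd

/-! ### Numbers of data points in balls around data points -/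

theorem sum_indicator_eq_ncard {ι Ω : Type*} [Fintype ι] (S : Set Ω) (y : ι → Ω) :
    ∑ j, S.indicator (fun _ => (1 : ℝ)) (y j) = ({j | y j ∈ S}.ncard : ℝ) := by
  classical
  rw [Set.ncard_eq_toFinset_card', Set.toFinset_ofPred, Finset.natCast_card_filter]
  exact Finset.sum_congr rfl fun j _ => Set.indicator_apply ..

theorem sum_succAbove_eq_ncard_sub {Ω : Type*} {m : ℕ} (S : Set (Ω × Ω)) (x : Fin (m + 1) → Ω)
    (i : Fin (m + 1)) :
    ∑ j : Fin m, S.indicator (fun _ => (1 : ℝ)) (x i, x (i.succAbove j)) =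
      ({j | (x i, x j) ∈ S}.ncard : ℝ) - S.indicator (fun _ => (1 : ℝ)) (x i, x i) := by
  rw [← sum_indicator_eq_ncard S fun j => (x i, x j), Fin.sum_univ_succAbove _ i]
  ring

/-- It is unlikely that a ball around a given data point is heavy but contains few data points. -/
theorem measureReal_few_points_le {d : ℕ} (hd : 1 ≤ d) (ν : Measure (Space d))
    [IsProbabilityMeasure ν] (hac : ν ≪ volume) {n k : ℕ} (hk : 1 ≤ k) (hkn : k ≤ n) {Δ : ℝ}
    (hΔ : 0 ≤ Δ) (hΔk : Δ ≤ k) (i : Fin n) :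
    (Measure.pi fun _ : Fin n => ν).real
      {x | ∃ r : ℝ, (k + Δ) / n ≤ ν.real (Metric.closedBall (x i) r) ∧
        {j | dist (x j) (x i) ≤ r}.ncard < k} ≤ Real.exp (-(Δ ^ 2 / (8 * k))) := by
  have : Nonempty (Fin d) := ⟨⟨0, hd⟩⟩
  obtain ⟨m, rfl⟩ : ∃ m, n = m + 1 := ⟨n - 1, by omega⟩
  have hk0 : (0 : ℝ) < k := by exact_mod_cast hk
  have hk1 : (1 : ℝ) ≤ k := by exact_mod_cast hk
  have hn0 : (0 : ℝ) < ((m + 1 : ℕ) : ℝ) := by positivity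
  set p : ℝ := (k + Δ) / ((m + 1 : ℕ) : ℝ) with hp
  have hp0 : 0 < p := by positivity
  have hpn : (m + 1) * p = k + Δ := by
    rw [hp]; push_cast; field_simp
  rcases lt_or_ge 1 p with hp1 | hp1
  · refine le_trans (le_of_eq ?_) (Real.exp_pos _).le
    convert measureReal_empty
    refine Set.eq_empty_iff_forall_notMem.2 ?_
    rintro x ⟨r, hr, -⟩
    exact absurd (hr.trans measureReal_le_one) (not_le.2 hp1)
  -- This `t` minimises `-t * Δ + 2 * k * t ^ 2`, the bound reached for the Chernoff exponent. The
  -- centre always counts itself, hence `k - 1` in place of `k` for the other points; on this tail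
  -- `m * p ≥ k + Δ - 1` compensates exactly.
  set t : ℝ := Δ / (4 * k) with ht
  have ht0 : 0 ≤ t := by positivity
  have ht1 : t ≤ 1 := by rw [ht, div_le_one (by positivity)]; linarith
  have hexp : Real.exp (-t) - 1 ≤ -t + t ^ 2 := by
    have := (abs_le.1 (Real.abs_exp_sub_one_sub_id_le (x := -t) (by rwa [abs_neg, abs_of_nonneg ht0]))).2
    linarith [neg_sq t]
  have hexp0 : Real.exp (-t) - 1 ≤ 0 := by
    have := Real.exp_le_one_iff.2 (neg_nonpos.2 ht0); linarith
  set S : Set (Space d × Space d) := {q | reachMass ν q < p} with hS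
  have hSm : MeasurableSet S := measurableSet_lt (measurable_reachMass ν) measurable_const
  have key := measureReal_pi_pair_le_exp ν m i S hSm (-t) (p * (Real.exp (-t) - 1)) (-t * (k - 1))
    fun c => mul_le_mul_of_nonpos_right (le_measureReal_reachMass_lt hd ν hac c hp1) hexp0
  refine (measureReal_mono ?_).trans (key.trans (Real.exp_le_exp.2 ?_))
  · rintro x ⟨r, hr, hc⟩
    have hself : (x i, x i) ∈ S := by
      simp only [hS, reachMass, Set.mem_ofPred_eq, dist_self, Metric.closedBall_zero]
      rw [measureReal_def, hac (measure_singleton _)]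
      simpa using hp0
    have hsub : {j | (x i, x j) ∈ S} ⊆ {j | dist (x j) (x i) ≤ r} := by
      intro j hj
      by_contra hlt
      have hlt' : r < dist (x j) (x i) := not_le.1 hlt
      exact absurd (hr.trans (measureReal_mono (Metric.closedBall_subset_closedBall hlt'.le)))
        (not_le.2 hj)
    have hc' : ({j | (x i, x j) ∈ S}.ncard : ℝ) ≤ k := by
      exact_mod_cast (Set.ncard_le_ncard hsub).trans hc.le
    rw [Set.mem_ofPred_eq, sum_succAbove_eq_ncard_sub, Set.indicator_of_mem hself]
    nlinarith
  · have h1 : (m : ℝ) * p = k + Δ - p := by linarith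
    have h2 : m * (p * (Real.exp (-t) - 1)) ≤ (k + Δ - 1) * (-t + t ^ 2) := by
      rw [← mul_assoc, h1]
      calc (k + Δ - p) * (Real.exp (-t) - 1) ≤ (k + Δ - 1) * (Real.exp (-t) - 1) :=
            mul_le_mul_of_nonpos_right (by linarith) hexp0
        _ ≤ _ := by gcongr; linarith
    have h3 : t * Δ = Δ ^ 2 / (4 * k) := by rw [ht]; ring
    have h4 : 2 * k * t ^ 2 = Δ ^ 2 / (8 * k) := by rw [ht]; field_simp; ring
    have h5 : Δ ^ 2 / (4 * k) = 2 * (Δ ^ 2 / (8 * k)) := by field_simp; ring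
    nlinarith [sq_nonneg t]

/-- It is unlikely that a ball around a given data point is light but contains many data points. -/
theorem measureReal_many_points_le {d : ℕ} (ν : Measure (Space d))
    [IsProbabilityMeasure ν] {n k : ℕ} (hk : 1 ≤ k) {Δ : ℝ}
    (hΔ : 2 ≤ Δ) (hΔk : Δ ≤ k) (i : Fin n) :
    (Measure.pi fun _ : Fin n => ν).real
      {x | ∃ r : ℝ, ν.real (Metric.closedBall (x i) r) ≤ (k - Δ) / n ∧
        k ≤ {j | dist (x j) (x i) ≤ r}.ncard} ≤ Real.exp (-(Δ ^ 2 / (16 * k))) := by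
  obtain ⟨m, rfl⟩ : ∃ m, n = m + 1 := ⟨n - 1, by have := i.2; omega⟩
  have hk0 : (0 : ℝ) < k := by exact_mod_cast hk
  have hn0 : (0 : ℝ) < ((m + 1 : ℕ) : ℝ) := by positivity
  set p : ℝ := (k - Δ) / ((m + 1 : ℕ) : ℝ) with hp
  have hp0 : 0 ≤ p := div_nonneg (by linarith) hn0.le
  have hpn : (m + 1) * p = k - Δ := by
    rw [hp]; push_cast; field_simp
  set t : ℝ := Δ / (4 * k) with ht
  have ht0 : 0 ≤ t := by positivity
  have ht1 : t ≤ 1 := by rw [ht, div_le_one (by positivity)]; linarith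
  have hexp : Real.exp t - 1 ≤ t + t ^ 2 := by
    have := (abs_le.1 (Real.abs_exp_sub_one_sub_id_le (x := t) (by rwa [abs_of_nonneg ht0]))).2
    linarith
  have hexp0 : 0 ≤ Real.exp t - 1 := by
    have := Real.one_le_exp ht0; linarith
  set S : Set (Space d × Space d) := {q | reachMass ν q ≤ p} with hS
  have hSm : MeasurableSet S := measurableSet_le (measurable_reachMass ν) measurable_const
  have key := measureReal_pi_pair_le_exp ν m i S hSm t (p * (Real.exp t - 1)) (t * (k - 1))
    fun c => mul_le_mul_of_nonneg_right (measureReal_reachMass_le ν c hp0) hexp0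
  refine (measureReal_mono ?_).trans (key.trans (Real.exp_le_exp.2 ?_))
  · rintro x ⟨r, hr, hc⟩
    have hsub : {j | dist (x j) (x i) ≤ r} ⊆ {j | (x i, x j) ∈ S} := by
      intro j hj
      exact (measureReal_mono (Metric.closedBall_subset_closedBall hj)).trans hr
    have hc' : (k : ℝ) ≤ ({j | (x i, x j) ∈ S}.ncard : ℝ) := by
      exact_mod_cast hc.trans (Set.ncard_le_ncard hsub)
    have hle : S.indicator (fun _ => (1 : ℝ)) (x i, x i) ≤ 1 :=
      Set.indicator_le_self' (fun _ _ => zero_le_one) _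
    rw [Set.mem_ofPred_eq, sum_succAbove_eq_ncard_sub]
    gcongr
  -- Here the self-count of the centre leaves an uncompensated `+t` in the exponent; `2 ≤ Δ` lets
  -- half of the gain `t * Δ` absorb it.
  · have h2 : m * (p * (Real.exp t - 1)) ≤ (k - Δ) * (t + t ^ 2) := by
      rw [← mul_assoc]
      have : (m : ℝ) * p ≤ k - Δ := by linarith
      gcongr
    have h3 : t * Δ = Δ ^ 2 / (4 * k) := by rw [ht]; ring
    have h4 : k * t ^ 2 = Δ ^ 2 / (16 * k) := by rw [ht]; field_simp; norm_num
    have h5 : Δ ^ 2 / (4 * k) = 4 * (Δ ^ 2 / (16 * k)) := by field_simp; ring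
    nlinarith [sq_nonneg t, mul_nonneg ht0 (sub_nonneg.2 hΔ), mul_nonneg (sq_nonneg t) (by linarith : 0 ≤ Δ)]

/-! ### Volume and mass -/

theorem unitBallVolume_pos (d : ℕ) : 0 < unitBallVolume d :=
  ENNReal.toReal_pos (Metric.measure_closedBall_pos volume _ one_pos).ne'
    (Metric.isCompact_of_isClosed_isBounded Metric.isClosed_closedBall
      Metric.isBounded_closedBall).measure_lt_top.ne

theorem volumeReal_closedBall {d : ℕ} (c : Space d) {r : ℝ} (hr : 0 ≤ r) :
    volume.real (Metric.closedBall c r) = unitBallVolume d * r ^ d := by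
  rw [Measure.addHaar_real_closedBall' _ _ hr, finrank_euclideanSpace_fin, mul_comm]
  rfl

theorem IsDensityOn.isProbabilityMeasure {d : ℕ} {X : Set (Space d)} {f : Space d → ℝ}
    (hf : IsDensityOn X f) : IsProbabilityMeasure (densityMeasure f) :=
  ⟨by rw [densityMeasure, withDensity_apply _ MeasurableSet.univ, Measure.restrict_univ,
    hf.lintegral_eq_one]⟩

theorem le_densityMeasure_real {d : ℕ} {X : Set (Space d)} {f : Space d → ℝ}
    (hf : IsDensityOn X f) {H : Set (Space d)} (hH : MeasurableSet H) {l : ℝ}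
    (hl : ∀ z ∈ H, l ≤ f z) (hl0 : 0 ≤ l) :
    l * volume.real H ≤ (densityMeasure f).real H := by
  have := hf.isProbabilityMeasure
  rw [measureReal_def, measureReal_def, ← ENNReal.toReal_ofReal hl0, ← ENNReal.toReal_mul]
  refine ENNReal.toReal_mono (measure_ne_top _ _) ?_
  rw [densityMeasure, withDensity_apply _ hH, ← setLIntegral_const]
  exact setLIntegral_mono' hH fun z hz => ENNReal.ofReal_le_ofReal (hl z hz)

theorem densityMeasure_real_le {d : ℕ} {f : Space d → ℝ} {H : Set (Space d)}
    (hH : MeasurableSet H) (hv : volume H ≠ ⊤) {u : ℝ} (hu : ∀ z ∈ H, f z ≤ u) (hu0 : 0 ≤ u) :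
    (densityMeasure f).real H ≤ u * volume.real H := by
  rw [measureReal_def, measureReal_def, ← ENNReal.toReal_ofReal hu0, ← ENNReal.toReal_mul]
  refine ENNReal.toReal_mono (ENNReal.mul_ne_top ENNReal.ofReal_ne_top hv) ?_
  rw [densityMeasure, withDensity_apply _ hH, ← setLIntegral_const]
  exact setLIntegral_mono' hH fun z hz => ENNReal.ofReal_le_ofReal (hu z hz)

/-! ### Half-balls -/

/-- The half of the closed ball of radius `ρ` around `a` that faces `b`. -/
def halfBall {d : ℕ} (a b : Space d) (ρ : ℝ) : Set (Space d) :=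
  {z | dist z a ≤ ρ ∧ 0 ≤ inner ℝ (z - a) (b - a)}

theorem measurableSet_halfBall {d : ℕ} (a b : Space d) (ρ : ℝ) :
    MeasurableSet (halfBall a b ρ) := by
  have h₁ : IsClosed {z : Space d | dist z a ≤ ρ} := isClosed_le (by fun_prop) (by fun_prop)
  have h₂ : IsClosed {z : Space d | 0 ≤ inner ℝ (z - a) (b - a)} :=
    isClosed_le (by fun_prop) (by fun_prop)
  exact (h₁.inter h₂).measurableSet

/-- The half-ball and its reflection through `a` cover the ball. -/
theorem volumeReal_halfBall_ge {d : ℕ} (a b : Space d) {ρ : ℝ} (hρ : 0 ≤ ρ) :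
    unitBallVolume d * ρ ^ d / 2 ≤ volume.real (halfBall a b ρ) := by
  set g : Space d → Space d := fun z => (a + a) - z with hg
  have hmp : MeasurePreserving g volume volume := Measure.measurePreserving_sub_left volume (a + a)
  have hsub : Metric.closedBall a ρ ⊆ halfBall a b ρ ∪ g ⁻¹' halfBall a b ρ := by
    intro z hz
    have hga : g z - a = -(z - a) := by simp only [hg]; abel
    rcases le_total 0 (inner ℝ (z - a) (b - a)) with h | h
    · exact Or.inl ⟨hz, h⟩
    · refine Or.inr ⟨?_, ?_⟩
      · rw [dist_eq_norm, hga, norm_neg, ← dist_eq_norm]; exact hz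
      · rw [hga, inner_neg_left]; linarith
  have hfin : volume (halfBall a b ρ) ≠ ⊤ :=
    ne_top_of_le_ne_top (measure_closedBall_lt_top (x := a) (r := ρ)).ne
      (measure_mono fun z hz => hz.1)
  have hpre : volume.real (g ⁻¹' halfBall a b ρ) = volume.real (halfBall a b ρ) := by
    rw [measureReal_def, hmp.measure_preimage (measurableSet_halfBall a b ρ).nullMeasurableSet]
    rfl
  have h1 := measureReal_mono (μ := volume) hsub (by
    refine (measure_union_lt_top hfin.lt_top ?_).ne
    rw [hmp.measure_preimage (measurableSet_halfBall a b ρ).nullMeasurableSet]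
    exact hfin.lt_top)
  have h2 := h1.trans (measureReal_union_le _ _)
  rw [hpre, volumeReal_closedBall a hρ] at h2
  linarith

/-! ### A finite net of balls on which the density is large -/

/-- A disjoint family of largest cardinality cannot be enlarged, so each box meets one of its
members. -/
theorem exists_finset_maximal_pairwiseDisjoint {β γ : Type*} (V : Set β) (box : β → Set γ)
    (hne : ∀ v ∈ V, (box v).Nonempty) (N : ℝ)
    (hN : ∀ F : Finset β, (F : Set β) ⊆ V → (F : Set β).PairwiseDisjoint box → (F.card : ℝ) ≤ N) :
    ∃ F : Finset β, (F : Set β) ⊆ V ∧ (F.card : ℝ) ≤ N ∧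
      ∀ v ∈ V, ∃ u ∈ F, (box v ∩ box u).Nonempty := by
  classical
  set K : Set ℕ := {m | ∃ F : Finset β, (F : Set β) ⊆ V ∧ (F : Set β).PairwiseDisjoint box ∧
    F.card = m} with hK
  have hKne : K.Nonempty := ⟨0, ∅, by simp⟩
  have hKb : BddAbove K := by
    refine ⟨⌊N⌋₊, ?_⟩
    rintro m ⟨F, hF, hd, rfl⟩
    exact Nat.le_floor (hN F hF hd)
  obtain ⟨F, hF, hd, hc⟩ := Nat.sSup_mem hKne hKb
  refine ⟨F, hF, hN F hF hd, fun v hv => ?_⟩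
  by_contra hcon
  push Not at hcon
  have hvF : v ∉ F := fun h => by
    have := hcon v h
    rw [Set.inter_self] at this
    exact (hne v hv).ne_empty this
  have hmem : F.card + 1 ∈ K := by
    refine ⟨insert v F, ?_, ?_, Finset.card_insert_of_notMem hvF⟩
    · rw [Finset.coe_insert]; exact Set.insert_subset hv hF
    · rw [Finset.coe_insert]
      exact hd.insert fun u hu _ => Set.disjoint_iff_inter_eq_empty.2 (hcon u hu)
  have := le_csSup hKb hmem
  omega

/-- A box below the graph of a density that exceeds `q / (v_d r ^ d)` near `c`, for
`u = (r, c)`. -/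
def densityBox (d : ℕ) (q : ℝ) (u : ℝ × Space d) : Set (Space d × ℝ) :=
  Metric.closedBall u.2 (u.1 / (200 * d)) ×ˢ
    Set.Ioo ((1 - 1 / (16 * d) : ℝ) ^ d * (q / (unitBallVolume d * u.1 ^ d)))
      (q / (unitBallVolume d * u.1 ^ d))

theorem shrink_pow_le {d : ℕ} (hd : 1 ≤ d) : (1 - 1 / (16 * d) : ℝ) ^ d ≤ 16 / 17 := by
  have hd1 : (1 : ℝ) ≤ d := by exact_mod_cast hd
  have h := Real.one_sub_div_pow_le_exp_neg (n := d) (t := 1 / 16) (by linarith)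
  have h2 : Real.exp (-(1 / 16)) ≤ 16 / 17 := by
    rw [Real.exp_neg, inv_le_comm₀ (Real.exp_pos _) (by norm_num)]
    have := Real.add_one_le_exp (1 / 16 : ℝ)
    norm_num at this ⊢
    linarith
  rw [show (1 / (16 * d) : ℝ) = 1 / 16 / d by field_simp]
  exact h.trans h2

theorem densityBox_volume_ge {d : ℕ} (hd : 1 ≤ d) {q : ℝ} (hq : 0 < q) {u : ℝ × Space d}
    (hu : 0 < u.1) :
    ENNReal.ofReal (q / (17 * (200 * d) ^ d)) ≤
      (volume : Measure (Space d)).prod volume (densityBox d q u) := by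
  have hd1 : (1 : ℝ) ≤ d := by exact_mod_cast hd
  have hv := unitBallVolume_pos d
  rw [densityBox, Measure.prod_prod, Real.volume_Ioo, ← ENNReal.ofReal_toReal
    (measure_closedBall_lt_top (x := u.2) (r := u.1 / (200 * d))).ne, ← measureReal_def,
    volumeReal_closedBall _ (by positivity), ← ENNReal.ofReal_mul (by positivity)]
  refine ENNReal.ofReal_le_ofReal ?_
  have h := shrink_pow_le hd
  have heq : unitBallVolume d * (u.1 / (200 * d)) ^ d *
      (q / (unitBallVolume d * u.1 ^ d) -
        (1 - 1 / (16 * d)) ^ d * (q / (unitBallVolume d * u.1 ^ d))) =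
      q / (200 * d) ^ d * (1 - (1 - 1 / (16 * d) : ℝ) ^ d) := by
    rw [div_pow]; field_simp
  rw [heq]
  calc q / (17 * (200 * d : ℝ) ^ d) = q / (200 * d) ^ d * (1 / 17) := by field_simp
    _ ≤ _ := by gcongr; linarith

theorem densityBox_nonempty {d : ℕ} (hd : 1 ≤ d) {q : ℝ} (hq : 0 < q) {u : ℝ × Space d}
    (hu : 0 < u.1) : (densityBox d q u).Nonempty := by
  have := unitBallVolume_pos d
  refine Set.Nonempty.prod ⟨u.2, Metric.mem_closedBall_self (by positivity)⟩ ?_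
  rw [Set.nonempty_Ioo]
  have h := shrink_pow_le hd
  have h2 : 0 < q / (unitBallVolume d * u.1 ^ d) := by positivity
  nlinarith

/-- A maximal packing: all the boxes lie between `0` and the graph of `f`, a region of volume one,
and each has volume at least `q / (17 * (200 * d) ^ d)`. Location and scale are discretised
together, with no bound on `X` or `f`. -/
theorem exists_net {d : ℕ} (hd : 1 ≤ d) {X : Set (Space d)} {f : Space d → ℝ}
    (hf : IsDensityOn X f) {q : ℝ} (hq : 0 < q) :
    ∃ F : Finset (ℝ × Space d), (∀ u ∈ F, 0 < u.1) ∧ (F.card : ℝ) ≤ 17 * (200 * d) ^ d / q ∧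
      ∀ u : ℝ × Space d, 0 < u.1 →
        (∀ z ∈ Metric.closedBall u.2 (u.1 / (200 * d)), q / (unitBallVolume d * u.1 ^ d) ≤ f z) →
        ∃ w ∈ F, (densityBox d q u ∩ densityBox d q w).Nonempty := by
  have hd1 : (1 : ℝ) ≤ d := by exact_mod_cast hd
  have hv := unitBallVolume_pos d
  set V : Set (ℝ × Space d) := {u | 0 < u.1 ∧
    ∀ z ∈ Metric.closedBall u.2 (u.1 / (200 * d)), q / (unitBallVolume d * u.1 ^ d) ≤ f z} with hV
  obtain ⟨F, hFV, hFc, hF⟩ := exists_finset_maximal_pairwiseDisjoint V (densityBox d q)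
    (fun u hu => densityBox_nonempty hd hq hu.1) (17 * (200 * d) ^ d / q) (by
      intro F hFV hdisj
      set b : ℝ := q / (17 * (200 * d) ^ d) with hb
      have hb0 : 0 < b := by positivity
      have hmeas : ∀ u ∈ F, MeasurableSet (densityBox d q u) := fun u _ =>
        Metric.isClosed_closedBall.measurableSet.prod measurableSet_Ioo
      have hsub : (⋃ u ∈ F, densityBox d q u) ⊆ regionBetween (fun _ => 0) f Set.univ := by
        refine Set.iUnion₂_subset fun u hu => ?_
        rintro ⟨z, t⟩ ⟨hz, ht1, ht2⟩
        have hu' := hFV hu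
        refine ⟨trivial, lt_of_le_of_lt ?_ ht1, ht2.trans_le (hu'.2 z hz)⟩
        have := hu'.1
        have h2 : 0 ≤ (1 - 1 / (16 * d) : ℝ) := by
          rw [sub_nonneg, div_le_one (by positivity)]; linarith
        positivity
      have h1 : (volume : Measure (Space d)).prod volume (⋃ u ∈ F, densityBox d q u) ≤ 1 := by
        refine (measure_mono hsub).trans ?_
        rw [volume_regionBetween_eq_lintegral' measurable_const hf.measurable MeasurableSet.univ]
        simp [hf.lintegral_eq_one]
      rw [measure_biUnion_finset hdisj hmeas] at h1
      have h2 : ENNReal.ofReal (F.card * b) ≤ 1 := by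
        refine le_trans ?_ h1
        rw [ENNReal.ofReal_mul (Nat.cast_nonneg _), ENNReal.ofReal_natCast, ← nsmul_eq_mul]
        exact Finset.card_nsmul_le_sum _ _ _ fun u hu =>
          densityBox_volume_ge hd hq (hFV hu).1
      rw [← ENNReal.ofReal_one, ENNReal.ofReal_le_ofReal_iff zero_le_one] at h2
      rw [le_div_iff₀ hq]
      rw [hb, ← mul_div_assoc, div_le_one (by positivity)] at h2
      exact h2)
  exact ⟨F, fun u hu => (hFV hu).1, hFc, fun u h0 hu => hF u ⟨h0, hu⟩⟩

/-- Points of intersecting boxes are close at comparable scales. -/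
theorem densityBox_inter {d : ℕ} (hd : 1 ≤ d) {q : ℝ} (hq : 0 < q) {u w : ℝ × Space d}
    (hu : 0 < u.1) (hw : 0 < w.1) (h : (densityBox d q u ∩ densityBox d q w).Nonempty) :
    dist u.2 w.2 ≤ (u.1 + w.1) / (200 * d) ∧ (1 - 1 / (16 * d)) * u.1 ≤ w.1 ∧
      (1 - 1 / (16 * d)) * w.1 ≤ u.1 := by
  obtain ⟨⟨z, t⟩, ⟨hzu, htu1, htu2⟩, ⟨hzw, htw1, htw2⟩⟩ := h
  have hd1 : (1 : ℝ) ≤ d := by exact_mod_cast hd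
  have hv := unitBallVolume_pos d
  have h2 : 0 ≤ (1 - 1 / (16 * d) : ℝ) := by
    rw [sub_nonneg, div_le_one (by positivity)]; linarith
  have aux : ∀ a b : ℝ, 0 < a → 0 < b → (1 - 1 / (16 * d) : ℝ) ^ d *
      (q / (unitBallVolume d * a ^ d)) < q / (unitBallVolume d * b ^ d) →
      (1 - 1 / (16 * d)) * b ≤ a := by
    intro a b ha hb hab
    rw [← mul_div_assoc, div_lt_div_iff₀ (by positivity) (by positivity)] at hab
    refine le_of_lt (lt_of_pow_lt_pow_left₀ d ha.le ?_)
    rw [mul_pow]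
    have hqv : 0 < q * unitBallVolume d := by positivity
    refine lt_of_mul_lt_mul_left (a := q * unitBallVolume d) ?_ hqv.le
    linarith
  refine ⟨?_, aux _ _ hw hu (htw1.trans htu2), aux _ _ hu hw (htu1.trans htw2)⟩
  rw [add_div, dist_comm u.2]
  have h1 := Metric.mem_closedBall.1 hzu
  have h2 := Metric.mem_closedBall'.1 hzw
  linarith [dist_triangle w.2 z u.2]

/-- Facing `b` means `|z - b|² ≤ |z - a|² + |a - b|²`, which is about `2 * s ^ 2`. Shrinking the
radius by the factor `1 - 1 / (4 * d)` gains a multiple of `s / d`, more than the net errors in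
position and scale cost; volume drops only by a constant factor. -/
theorem halfBall_net_subset {d : ℕ} (hd : 1 ≤ d) {s s₁ s₂ : ℝ} {x y a b : Space d}
    (hs : 0 < s) (hxy : dist x y ≤ s)
    (ha : dist y a ≤ (s + s₂) / (200 * d)) (h₂ : (1 - 1 / (16 * d)) * s₂ ≤ s)
    (hb : dist x b ≤ (s + s₁) / (200 * d)) (h₁ : (1 - 1 / (16 * d)) * s₁ ≤ s) {z : Space d}
    (hz : z ∈ halfBall a b ((1 - 1 / (4 * d)) * s₂)) :
    dist z y ≤ s ∧ dist z x ≤ √2 * s := by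
  have hd1 : (1 : ℝ) ≤ d := by exact_mod_cast hd
  set D : ℝ := 1 / d with hD
  have hD0 : 0 < D := by positivity
  have hD1 : D ≤ 1 := by rw [hD, div_le_one (by positivity)]; exact hd1
  rw [show (1 / (16 * d) : ℝ) = D / 16 by rw [hD]; field_simp] at h₁ h₂
  have key : ∀ t, (1 - D / 16) * t ≤ s → t ≤ (1 + D / 8) * s := by
    intro t ht
    have h3 : 1 ≤ (1 + D / 8) * (1 - D / 16) := by nlinarith
    by_contra hcon
    push Not at hcon
    have h4 : 0 < 1 - D / 16 := by linarith
    nlinarith [mul_lt_mul_of_pos_left hcon h4]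
  have k₁ := key s₁ h₁
  have k₂ := key s₂ h₂
  have hDs : D * s ≤ s := by nlinarith
  have dist_le : ∀ t, t ≤ (1 + D / 8) * s → (s + t) / (200 * d) ≤ 0.011 * D * s := by
    intro t ht
    rw [show (s + t) / (200 * d) = (s + t) * D / 200 by rw [hD]; field_simp]
    nlinarith
  have ha' := ha.trans (dist_le s₂ k₂)
  have hb' := hb.trans (dist_le s₁ k₁)
  have hρ : (1 - 1 / (4 * d)) * s₂ ≤ (1 - D / 8) * s := by
    rw [show (1 / (4 * d) : ℝ) = D / 4 by rw [hD]; field_simp]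
    have : (1 - D / 4) * s₂ ≤ (1 - D / 4) * ((1 + D / 8) * s) :=
      mul_le_mul_of_nonneg_left k₂ (by linarith)
    nlinarith [mul_pos hD0 hs, mul_pos hD0 (mul_pos hD0 hs)]
  have hza : dist z a ≤ (1 - D / 8) * s := hz.1.trans hρ
  have hab : dist a b ≤ (1 + 0.022 * D) * s := by
    have := dist_triangle4 a y x b
    rw [dist_comm a y, dist_comm y x] at this
    linarith
  refine ⟨?_, ?_⟩
  · have := dist_triangle z a y
    rw [dist_comm a y] at this
    nlinarith [mul_pos hD0 hs]
  · have hsq : dist z b ^ 2 ≤ dist z a ^ 2 + dist a b ^ 2 := by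
      have h := norm_sub_sq_real (z - a) (b - a)
      rw [sub_sub_sub_cancel_right] at h
      rw [dist_eq_norm, dist_eq_norm, dist_comm a b, dist_eq_norm, h]
      linarith [hz.2]
    have h1 : dist z a ^ 2 ≤ ((1 - D / 8) * s) ^ 2 := by gcongr
    have h2 : dist a b ^ 2 ≤ ((1 + 0.022 * D) * s) ^ 2 := by gcongr
    have hr2 : (√2) ^ 2 = 2 := Real.sq_sqrt (by norm_num)
    have hr : √2 ≤ 1.5 := by rw [Real.sqrt_le_left (by norm_num)]; norm_num
    have hr1 : 1 ≤ √2 := Real.one_le_sqrt.2 (by norm_num)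
    have hzb : dist z b ≤ (√2 - 0.011 * D) * s := by
      refine le_of_sq_le_sq ?_ (mul_nonneg (by linarith) hs.le)
      have h3 : (1 - D / 8) ^ 2 + (1 + 0.022 * D) ^ 2 ≤ (√2 - 0.011 * D) ^ 2 := by
        nlinarith
      calc _ ≤ ((1 - D / 8) ^ 2 + (1 + 0.022 * D) ^ 2) * s ^ 2 := by linarith
        _ ≤ (√2 - 0.011 * D) ^ 2 * s ^ 2 := by gcongr
        _ = _ := by ring
    have := dist_triangle z b x
    rw [dist_comm b x] at this
    linarith

/-- Wherever the density is at least `q / (v_d s ^ d)`, the sample meets all half-balls of radius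
`s`; here a half-ball around `y` is given by a point in its direction. -/
def HitsHalfBalls {d n : ℕ} (f : Space d → ℝ) (q : ℝ) (x : Fin n → Space d) : Prop :=
  ∀ s : ℝ, 0 < s → ∀ y b : Space d, dist b y ≤ s →
    (∀ z ∈ Metric.closedBall y (2 * s), q / (unitBallVolume d * s ^ d) ≤ f z) →
    ∃ j, dist (x j) y ≤ s ∧ dist (x j) b ≤ √2 * s

theorem measureReal_pi_forall_notMem_le {Ω : Type*} [MeasurableSpace Ω] (ν : Measure Ω)
    [IsProbabilityMeasure ν] (n : ℕ) {H : Set Ω} (hH : MeasurableSet H) {p : ℝ}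
    (hp : p ≤ ν.real H) :
    (Measure.pi fun _ : Fin n => ν).real {x | ∀ j, x j ∉ H} ≤ Real.exp (-(n * p)) := by
  have heq : {x : Fin n → Ω | ∀ j, x j ∉ H} = Set.univ.pi fun _ => Hᶜ := by
    ext x; simp
  rw [heq, measureReal_def, Measure.pi_pi, Finset.prod_const, ENNReal.toReal_pow,
    ← measureReal_def, probReal_compl_eq_one_sub hH, Finset.card_univ, Fintype.card_fin]
  rw [show -(n * p) = n * (-p) by ring, Real.exp_nat_mul]
  have h1 : 0 ≤ 1 - ν.real H := by linarith [measureReal_le_one (μ := ν) (s := H)]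
  gcongr
  linarith [Real.add_one_le_exp (-p)]

theorem measureReal_not_hitsHalfBalls_le {d n : ℕ} (hd : 1 ≤ d) {X : Set (Space d)}
    {f : Space d → ℝ} (hf : IsDensityOn X f) {q : ℝ} (hq : 0 < q) :
    (sampleMeasure f n).real {x | ¬ HitsHalfBalls f q x} ≤
      (17 * (200 * d) ^ d / q) ^ 2 * Real.exp (-(n * (q / 4))) := by
  classical
  have := hf.isProbabilityMeasure
  have hd1 : (1 : ℝ) ≤ d := by exact_mod_cast hd
  have hv := unitBallVolume_pos d
  obtain ⟨F, hF0, hFc, hF⟩ := exists_net hd hf hq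
  set H : (ℝ × Space d) × (ℝ × Space d) → Set (Space d) := fun p =>
    halfBall p.1.2 p.2.2 ((1 - 1 / (4 * d)) * p.1.1) with hH
  -- Every failure leaves empty the half-ball of some net pair, and that half-ball is heavy: one
  -- factor `1 / 2` is lost to halving the ball and at most another to the smaller radius. So only
  -- pairs of mass at least `q / 4` enter the union bound.
  set G := (F ×ˢ F).filter fun p => q / 4 ≤ (densityMeasure f).real (H p) with hG
  have hsub : {x : Fin n → Space d | ¬ HitsHalfBalls f q x} ⊆
      ⋃ p ∈ G, {x | ∀ j, x j ∉ H p} := by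
    intro x hx
    simp only [HitsHalfBalls, Set.mem_ofPred_eq] at hx
    push Not at hx
    obtain ⟨s, hs, y, b, hby, hfy, hno⟩ := hx
    have hsmall : ∀ c : Space d, dist c y ≤ s →
        ∀ z ∈ Metric.closedBall c (s / (200 * d)), q / (unitBallVolume d * s ^ d) ≤ f z := by
      intro c hc z hz
      refine hfy z (Metric.mem_closedBall.2 ?_)
      have h1 := Metric.mem_closedBall.1 hz
      have h2 : s / (200 * d) ≤ s := div_le_self hs.le (by linarith)
      linarith [dist_triangle z c y]
    obtain ⟨u, huF, hu⟩ := hF (s, y) hs (hsmall y (by simpa using hs.le))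
    obtain ⟨w, hwF, hw⟩ := hF (s, b) hs (hsmall b hby)
    obtain ⟨hu1, hu2, hu3⟩ := densityBox_inter hd hq hs (hF0 u huF) hu
    obtain ⟨hw1, hw2, hw3⟩ := densityBox_inter hd hq hs (hF0 w hwF) hw
    have hin : ∀ z ∈ H (u, w), dist z y ≤ s ∧ dist z b ≤ √2 * s := fun z hz =>
      halfBall_net_subset hd hs hby hu1 hu3 hw1 hw3 hz
    refine Set.mem_iUnion₂.2 ⟨(u, w), ?_, fun j hj => ?_⟩
    · rw [hG, Finset.mem_filter]
      refine ⟨Finset.mk_mem_product huF hwF, ?_⟩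
      have hρ0 : 0 ≤ (1 - 1 / (4 * d) : ℝ) := by
        rw [sub_nonneg, div_le_one (by positivity)]; linarith
      have hu0 := hF0 u huF
      have hmass := le_densityMeasure_real hf
        (measurableSet_halfBall u.2 w.2 ((1 - 1 / (4 * d)) * u.1))
        (l := q / (unitBallVolume d * s ^ d))
        (fun z hz => hfy z (Metric.mem_closedBall.2 ((hin z hz).1.trans (by linarith))))
        (by positivity)
      have hvol := volumeReal_halfBall_ge u.2 w.2 (ρ := (1 - 1 / (4 * d)) * u.1) (by positivity)
      refine le_trans ?_ hmass
      have hpow : s ^ d / 2 ≤ ((1 - 1 / (4 * d)) * u.1) ^ d := by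
        have b1 : (3 / 4 : ℝ) ≤ (1 - 1 / (4 * d)) ^ d := by
          have := one_add_mul_le_pow (a := (-(1 / (4 * d)) : ℝ)) (by linarith) d
          rw [← sub_eq_add_neg] at this
          refine le_trans (le_of_eq ?_) this
          field_simp; norm_num
        have b2 : (15 / 16 : ℝ) ≤ (1 - 1 / (16 * d)) ^ d := by
          have h16 : (1 / (16 * d) : ℝ) ≤ 1 := by
            rw [div_le_one (by positivity)]; linarith
          have := one_add_mul_le_pow (a := (-(1 / (16 * d)) : ℝ)) (by linarith) d
          rw [← sub_eq_add_neg] at this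
          refine le_trans (le_of_eq ?_) this
          field_simp; norm_num
        have b3 : (1 - 1 / (16 * d) : ℝ) ^ d * s ^ d ≤ u.1 ^ d := by
          rw [← mul_pow]
          refine pow_le_pow_left₀ (mul_nonneg ?_ hs.le) hu2 d
          rw [sub_nonneg, div_le_one (by positivity)]; linarith
        have hsd : 0 < s ^ d := by positivity
        rw [mul_pow]
        calc s ^ d / 2 ≤ 3 / 4 * (15 / 16 * s ^ d) := by linarith
          _ ≤ 3 / 4 * ((1 - 1 / (16 * d) : ℝ) ^ d * s ^ d) := by gcongr
          _ ≤ (1 - 1 / (4 * d)) ^ d * u.1 ^ d := by gcongr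
      calc q / 4 = q / (unitBallVolume d * s ^ d) * (unitBallVolume d * (s ^ d / 2) / 2) := by
            field_simp; norm_num
        _ ≤ q / (unitBallVolume d * s ^ d) *
            (unitBallVolume d * ((1 - 1 / (4 * d)) * u.1) ^ d / 2) := by gcongr
        _ ≤ _ := by gcongr
    · obtain ⟨h1, h2⟩ := hin _ hj
      exact absurd h2 (not_le.2 (hno j h1))
  have : IsProbabilityMeasure (sampleMeasure f n) := by unfold sampleMeasure; infer_instance
  calc (sampleMeasure f n).real {x | ¬ HitsHalfBalls f q x}
      ≤ (sampleMeasure f n).real (⋃ p ∈ G, {x | ∀ j, x j ∉ H p}) :=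
        measureReal_mono hsub (measure_ne_top _ _)
    _ ≤ ∑ p ∈ G, (sampleMeasure f n).real {x | ∀ j, x j ∉ H p} :=
        measureReal_biUnion_finset_le _ _
    _ ≤ ∑ _p ∈ G, Real.exp (-(n * (q / 4))) := Finset.sum_le_sum fun p hp =>
        measureReal_pi_forall_notMem_le _ n (measurableSet_halfBall ..) (Finset.mem_filter.1 hp).2
    _ = G.card * Real.exp (-(n * (q / 4))) := by rw [Finset.sum_const, nsmul_eq_mul]
    _ ≤ (17 * (200 * d) ^ d / q) ^ 2 * Real.exp (-(n * (q / 4))) := by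
        have hG2 : (G.card : ℝ) ≤ (F.card : ℝ) ^ 2 := by
          have := Finset.card_filter_le (F ×ˢ F) fun p => q / 4 ≤ (densityMeasure f).real (H p)
          rw [Finset.card_product, ← sq] at this
          exact_mod_cast this
        have : (F.card : ℝ) ^ 2 ≤ (17 * (200 * d) ^ d / q) ^ 2 := by gcongr
        exact mul_le_mul_of_nonneg_right (hG2.trans this) (Real.exp_pos _).le

/-! ### Samples whose empirical masses are close to the true ones -/

/-- The mass from which on all relevant half-balls contain data points. -/
def hitMass (d n : ℕ) (L : ℝ) : ℝ := 400 * (d * Real.log n * L) / n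

/-- The properties of a typical sample from which the guarantees follow. -/
structure IsTypicalSample {d n : ℕ} (f : Space d → ℝ) (L : ℝ) (k : ℕ) (x : Fin n → Space d) :
    Prop where
  pos : ∀ i, 0 < f (x i)
  le_ncard : ∀ i r, k / n + deviation (20 * L) d n k ≤
    (densityMeasure f).real (Metric.closedBall (x i) r) → k ≤ {j | dist (x j) (x i) ≤ r}.ncard
  -- For `n = 1` the deviation vanishes with `log n`, and the implication fails when `k = 1`.
  ncard_lt : 2 ≤ n → ∀ i r, (densityMeasure f).real (Metric.closedBall (x i) r) ≤
    k / n - deviation (20 * L) d n k → {j | dist (x j) (x i) ≤ r}.ncard < k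
  hitsHalfBalls : 2 ≤ n → k ≤ n → HitsHalfBalls f (hitMass d n L) x

theorem measureReal_iUnion_fin_le {Ω : Type*} [MeasurableSpace Ω] (μ : Measure Ω)
    [IsFiniteMeasure μ] {n : ℕ} (s : Fin n → Set Ω) {b : ℝ} (hb : ∀ i, μ.real (s i) ≤ b) :
    μ.real (⋃ i, s i) ≤ n * b := by
  refine (measureReal_iUnion_fintype_le s).trans ?_
  refine (Finset.sum_le_sum fun i _ => hb i).trans_eq ?_
  rw [Finset.sum_const, Finset.card_univ, Fintype.card_fin, nsmul_eq_mul]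

theorem sampleMeasure_exists_nonpos {d n : ℕ} {X : Set (Space d)} {f : Space d → ℝ}
    (hf : IsDensityOn X f) : sampleMeasure f n {x | ∃ i, f (x i) ≤ 0} = 0 := by
  have := hf.isProbabilityMeasure
  have h0 : densityMeasure f {y | f y ≤ 0} = 0 := by
    have hm : MeasurableSet {y | f y ≤ 0} := measurableSet_le hf.measurable measurable_const
    rw [densityMeasure, withDensity_apply _ hm, setLIntegral_congr_fun (g := fun _ => 0) hm]
    · simp
    · intro y hy; exact ENNReal.ofReal_of_nonpos hy
  have : {x : Fin n → Space d | ∃ i, f (x i) ≤ 0} =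
      ⋃ i, Function.eval i ⁻¹' {y | f y ≤ 0} := by
    ext x; simp
  rw [this, measure_iUnion_null_iff]
  exact fun i => Measure.pi_eval_preimage_null _ h0

theorem natCast_div_add_deviation (L : ℝ) (d n k : ℕ) :
    (k : ℝ) / n + deviation (20 * L) d n k = (k + 20 * L * √(k * d * Real.log n)) / n := by
  rw [deviation]; ring

theorem natCast_div_sub_deviation (L : ℝ) (d n k : ℕ) :
    (k : ℝ) / n - deviation (20 * L) d n k = (k - 20 * L * √(k * d * Real.log n)) / n := by
  rw [deviation]; ring

/-! ### Numerical consequences of the sample-size condition -/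

section Numerics

variable {d n k : ℕ} {δ ε : ℝ}

theorem log_two_lt_log_two_div (hδ : 0 < δ) (hδ1 : δ < 1) : 0.69 < Real.log (2 / δ) := by
  have h1 : Real.log 2 < Real.log (2 / δ) :=
    Real.log_lt_log (by norm_num) (by rw [lt_div_iff₀ hδ]; linarith)
  linarith [Real.log_two_gt_d9]

theorem dimension_mul_log_bounds (hd : 1 ≤ d) (hn : 2 ≤ n) : 0.69 < d * Real.log n ∧
    Real.log n ≤ d * Real.log n ∧ 0.69 < Real.log n ∧ 0.69 * d ≤ d * Real.log n := by
  have hd1 : (1 : ℝ) ≤ d := by exact_mod_cast hd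
  have h1 : Real.log 2 ≤ Real.log n := Real.log_le_log (by norm_num) (by exact_mod_cast hn)
  have h2 := Real.log_two_gt_d9
  refine ⟨by nlinarith, by nlinarith, by linarith, by nlinarith⟩

/-- The left side is `δ ^ 2 / 4`. Each of the three non-null bad events is given the budget `δ / 4`.
-/
theorem exp_neg_two_mul_le (hδ : 0 < δ) (hδ1 : δ < 1) :
    Real.exp (-(2 * Real.log (2 / δ))) ≤ δ / 4 := by
  rw [show -(2 * Real.log (2 / δ)) = (2 : ℕ) * Real.log (δ / 2) by
    rw [← inv_div, Real.log_inv]; push_cast; ring, Real.exp_nat_mul,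
    Real.exp_log (by positivity)]
  nlinarith

theorem le_of_sampleSize (hε : 0 < ε)
    (hk : 10000 * (d * Real.log n / ε ^ 2) * Real.log (2 / δ) ^ 2 ≤ (k : ℝ)) :
    10000 * (d * Real.log n) * Real.log (2 / δ) ^ 2 ≤ ε ^ 2 * k := by
  rw [mul_comm (ε ^ 2), ← div_le_iff₀ (by positivity)]
  refine le_trans (le_of_eq ?_) hk
  ring

theorem sq_scaled_deviation (hn : 1 ≤ n) :
    (20 * Real.log (2 / δ) * √(k * d * Real.log n)) ^ 2 =
      400 * (d * Real.log n) * Real.log (2 / δ) ^ 2 * k := by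
  have : 0 ≤ Real.log n := Real.log_nonneg (by exact_mod_cast hn)
  rw [mul_pow, Real.sq_sqrt (by positivity)]
  ring

theorem scaled_deviation_nonneg (hδ : 0 < δ) (hδ1 : δ < 1) :
    0 ≤ 20 * Real.log (2 / δ) * √(k * d * Real.log n) := by
  have := log_two_lt_log_two_div hδ hδ1
  positivity

/-- This ties together the constants: `400 / 10000 = (1 / 5) ^ 2`. -/
theorem scaled_deviation_le (hn : 1 ≤ n) (hε : 0 < ε)
    (hk : 10000 * (d * Real.log n / ε ^ 2) * Real.log (2 / δ) ^ 2 ≤ (k : ℝ)) :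
    20 * Real.log (2 / δ) * √(k * d * Real.log n) ≤ ε / 5 * k := by
  refine abs_le_of_sq_le_sq' ?_ (by positivity) |>.2
  rw [sq_scaled_deviation hn]
  have := le_of_sampleSize hε hk
  have hk0 : (0 : ℝ) ≤ k := Nat.cast_nonneg _
  nlinarith

theorem two_le_scaled_deviation (hd : 1 ≤ d) (hn : 2 ≤ n) (hk1 : 1 ≤ k) (hδ : 0 < δ)
    (hδ1 : δ < 1) : 2 ≤ 20 * Real.log (2 / δ) * √(k * d * Real.log n) := by
  refine abs_le_of_sq_le_sq' ?_ (scaled_deviation_nonneg hδ hδ1) |>.2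
  rw [sq_scaled_deviation (by omega)]
  have h1 := (dimension_mul_log_bounds hd hn).1
  have h2 := log_two_lt_log_two_div hδ hδ1
  have h3 : (1 : ℝ) ≤ k := by exact_mod_cast hk1
  calc (2 : ℝ) ^ 2 ≤ 400 * 0.69 * 0.69 ^ 2 * 1 := by norm_num
    _ ≤ _ := by gcongr

theorem natCast_mul_exp_le (hd : 1 ≤ d) (hn : 2 ≤ n) (hδ : 0 < δ) (hδ1 : δ < 1) :
    n * Real.exp (-(25 * (d * Real.log n) * Real.log (2 / δ) ^ 2)) ≤ δ / 4 := by
  refine le_trans ?_ (exp_neg_two_mul_le hδ hδ1)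
  have hn0 : (0 : ℝ) < n := by positivity
  obtain ⟨h1, h2, -, -⟩ := dimension_mul_log_bounds hd hn
  have h3 := log_two_lt_log_two_div hδ hδ1
  nth_rewrite 1 [← Real.exp_log hn0]
  rw [← Real.exp_add]
  refine Real.exp_le_exp.2 ?_
  set D := d * Real.log n
  set L := Real.log (2 / δ)
  have h4 : 0.4 ≤ L ^ 2 := by nlinarith
  have h5 : 0.4 ≤ D * L := by nlinarith
  nlinarith [mul_le_mul_of_nonneg_left h4 (by linarith : 0 ≤ D), mul_le_mul_of_nonneg_left h5 (by linarith : 0 ≤ L)]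

/-- Since `d ≤ n` and `200 ≤ n ^ 8`, the net has at most `exp (10 * d * log n)` elements. The
constant `400` in `hitMass` makes the exponent `-100 * d * log n * L`, which beats the square of
that number. -/
theorem net_mul_exp_le (hd : 1 ≤ d) (hn : 2 ≤ n) (hdn : d ≤ n) (hδ : 0 < δ) (hδ1 : δ < 1) :
    (17 * (200 * d) ^ d / hitMass d n (Real.log (2 / δ))) ^ 2 *
      Real.exp (-(n * (hitMass d n (Real.log (2 / δ)) / 4))) ≤ δ / 4 := by
  refine le_trans ?_ (exp_neg_two_mul_le hδ hδ1)
  have hn0 : (0 : ℝ) < n := by positivity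
  obtain ⟨h1, h2, -, -⟩ := dimension_mul_log_bounds hd hn
  have h3 := log_two_lt_log_two_div hδ hδ1
  rw [hitMass]
  set L := Real.log (2 / δ)
  have hD0 : 0 < d * Real.log n := by linarith
  have h5 : 0.4 ≤ d * Real.log n * L := by nlinarith
  have hn2 : (2 : ℝ) ≤ n := by exact_mod_cast hn
  have hdn' : (d : ℝ) ≤ n := by exact_mod_cast hdn
  have hN : 17 * (200 * d) ^ d / (400 * (d * Real.log n * L) / n) ≤
      Real.exp (10 * (d * Real.log n)) := by
    have h200 : (200 : ℝ) ≤ n ^ 8 :=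
      calc (200 : ℝ) ≤ 2 ^ 8 := by norm_num
        _ ≤ n ^ 8 := by gcongr
    have hexp : Real.exp (10 * (d * Real.log n)) = ((n : ℝ) ^ 10) ^ d := by
      rw [← Real.exp_log hn0, ← Real.exp_nat_mul, ← Real.exp_nat_mul, Real.exp_log hn0]
      push_cast; ring_nf
    rw [hexp]
    calc 17 * (200 * d) ^ d / (400 * (d * Real.log n * L) / n)
        ≤ 17 * (n ^ 8 * n) ^ d / (400 * 0.4 / n) := by gcongr
      _ = 17 / 160 * (n * (n ^ 9) ^ d) := by field_simp; ring
      _ ≤ 1 * (n ^ d * (n ^ 9) ^ d) := by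
          gcongr
          · norm_num
          · exact le_self_pow₀ (by linarith) (by omega)
      _ = ((n : ℝ) ^ 10) ^ d := by rw [one_mul, ← mul_pow, ← pow_succ']
  calc _ ≤ Real.exp (10 * (d * Real.log n)) ^ 2 *
        Real.exp (-(n * (400 * (d * Real.log n * L) / n / 4))) := by gcongr
    _ = Real.exp (20 * (d * Real.log n) - 100 * (d * Real.log n * L)) := by
        rw [← Real.exp_nat_mul, ← Real.exp_add]
        congr 1
        field_simp
        push_cast; ring
    _ ≤ _ := by
        refine Real.exp_le_exp.2 ?_
        nlinarith [mul_lt_mul_of_pos_left h1 (by linarith : 0 < L)]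

theorem dimension_le_of_sampleSize (hd : 1 ≤ d) (hn : 2 ≤ n) (hkn : k ≤ n) (hδ : 0 < δ)
    (hδ1 : δ < 1) (hε : 0 < ε) (hε1 : ε < 1)
    (hk : 10000 * (d * Real.log n / ε ^ 2) * Real.log (2 / δ) ^ 2 ≤ (k : ℝ)) : d ≤ n := by
  obtain ⟨h1, -, -, h2⟩ := dimension_mul_log_bounds hd hn
  have h3 := log_two_lt_log_two_div hδ hδ1
  have h4 := le_of_sampleSize hε hk
  have h5 : 0.4 ≤ Real.log (2 / δ) ^ 2 := by nlinarith
  have h6 : ε ^ 2 * k ≤ k := mul_le_of_le_one_left (Nat.cast_nonneg _) (by nlinarith)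
  have h7 : (d : ℝ) ≤ k := by nlinarith
  exact (by exact_mod_cast h7 : d ≤ k).trans hkn

end Numerics

theorem sampleMeasure_not_isTypicalSample_le {d n k : ℕ} {X : Set (Space d)} {f : Space d → ℝ}
    {δ ε : ℝ} (hd : 1 ≤ d) (hn : 1 ≤ n) (hk1 : 1 ≤ k) (hf : IsDensityOn X f) (hδ : 0 < δ)
    (hδ1 : δ < 1) (hε : 0 < ε) (hε1 : ε < 1)
    (hk : 10000 * (d * Real.log n / ε ^ 2) * Real.log (2 / δ) ^ 2 ≤ (k : ℝ)) :
    (sampleMeasure f n).real {x | ¬ IsTypicalSample f (Real.log (2 / δ)) k x} ≤ δ := by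
  have := hf.isProbabilityMeasure
  have : IsProbabilityMeasure (sampleMeasure f n) := by unfold sampleMeasure; infer_instance
  have hac : densityMeasure f ≪ volume := withDensity_absolutelyContinuous _ _
  set L := Real.log (2 / δ) with hL
  set Δ := 20 * L * √(k * d * Real.log n) with hΔ
  have hk0 : (0 : ℝ) < k := by exact_mod_cast hk1
  have hΔ0 : 0 ≤ Δ := scaled_deviation_nonneg hδ hδ1
  have hΔk : Δ ≤ k := (scaled_deviation_le hn hε hk).trans (by nlinarith)
  have hΔsq : Δ ^ 2 = 400 * (d * Real.log n) * L ^ 2 * k := sq_scaled_deviation hn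
  have hexp16 : Δ ^ 2 / (16 * k) = 25 * (d * Real.log n) * L ^ 2 := by
    rw [hΔsq]; field_simp; ring
  have hexp8 : 25 * (d * Real.log n) * L ^ 2 ≤ Δ ^ 2 / (8 * k) := by
    rw [← hexp16]; gcongr; norm_num
  set B₁ : Set (Fin n → Space d) := {x | ∃ i, f (x i) ≤ 0}
  set B₂ : Set (Fin n → Space d) := ⋃ i, {x | ∃ r : ℝ, (k + Δ) / n ≤
    (densityMeasure f).real (Metric.closedBall (x i) r) ∧ {j | dist (x j) (x i) ≤ r}.ncard < k}
    with hB₂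
  set B₃ : Set (Fin n → Space d) := {x | 2 ≤ n ∧ x ∈ ⋃ i, {x | ∃ r : ℝ,
    (densityMeasure f).real (Metric.closedBall (x i) r) ≤ (k - Δ) / n ∧
      k ≤ {j | dist (x j) (x i) ≤ r}.ncard}} with hB₃
  set B₄ : Set (Fin n → Space d) := {x | 2 ≤ n ∧ k ≤ n ∧ ¬ HitsHalfBalls f (hitMass d n L) x}
    with hB₄
  have hsub : {x : Fin n → Space d | ¬ IsTypicalSample f L k x} ⊆ B₁ ∪ (B₂ ∪ (B₃ ∪ B₄)) := by
    intro x hx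
    by_contra hcon
    simp only [Set.mem_union, not_or] at hcon
    obtain ⟨h1, h2, h3, h4⟩ := hcon
    refine hx ⟨fun i => ?_, fun i r hr => ?_, fun h2n i r hr => ?_, fun h2n hkn => ?_⟩
    · by_contra h; exact h1 ⟨i, not_lt.1 h⟩
    · rw [natCast_div_add_deviation] at hr
      by_contra h
      exact h2 (Set.mem_iUnion.2 ⟨i, r, hr, not_le.1 h⟩)
    · rw [natCast_div_sub_deviation] at hr
      by_contra h
      exact h3 ⟨h2n, Set.mem_iUnion.2 ⟨i, r, hr, not_lt.1 h⟩⟩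
    · by_contra h
      exact h4 ⟨h2n, hkn, h⟩
  have e₁ : (sampleMeasure f n).real B₁ = 0 := by
    rw [measureReal_def, sampleMeasure_exists_nonpos hf, ENNReal.toReal_zero]
  have e₂ : (sampleMeasure f n).real B₂ ≤ δ / 4 := by
    rcases lt_or_ge n k with hnk | hkn
    -- A ball would need mass above one.
    · have : B₂ = ∅ := by
        refine Set.eq_empty_iff_forall_notMem.2 fun x hx => ?_
        obtain ⟨i, r, hr, -⟩ := Set.mem_iUnion.1 hx
        have h1 := hr.trans measureReal_le_one
        have hn0 : (0 : ℝ) < n := by exact_mod_cast hn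
        rw [div_le_one hn0] at h1
        have h2 : (n : ℝ) < k := by exact_mod_cast hnk
        linarith
      rw [this, measureReal_empty]; positivity
    · rcases hn.lt_or_eq with h2n | rfl
      · refine (measureReal_iUnion_fin_le _ _ fun i => ?_).trans (natCast_mul_exp_le hd h2n hδ hδ1)
        refine (measureReal_few_points_le hd _ hac hk1 hkn hΔ0 hΔk i).trans ?_
        exact Real.exp_le_exp.2 (neg_le_neg hexp8)
      -- With `n = 1` the exponential bound is void because `log n = 0`. But `k = 1`, so a ball with
      -- fewer than `k` points has negative radius and no mass.
      · have : B₂ = ∅ := by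
          refine Set.eq_empty_iff_forall_notMem.2 fun x hx => ?_
          obtain ⟨i, r, hr, hlt⟩ := Set.mem_iUnion.1 hx
          have h0 : {j | dist (x j) (x i) ≤ r} = ∅ := by
            rw [← Set.ncard_eq_zero]; omega
          have hr0 : ¬ 0 ≤ r := fun h => by
            have : i ∈ {j | dist (x j) (x i) ≤ r} := by simpa using h
            rw [h0] at this; exact this
          rw [Metric.closedBall_eq_empty.2 (not_le.1 hr0), measureReal_empty] at hr
          have : 0 < (k + Δ) / ((1 : ℕ) : ℝ) := by positivity
          linarith
        rw [this, measureReal_empty]; positivity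
  have e₃ : (sampleMeasure f n).real B₃ ≤ δ / 4 := by
    by_cases h2n : 2 ≤ n
    · refine le_trans (measureReal_mono (fun x hx => hx.2)) <|
        (measureReal_iUnion_fin_le _ _ fun i => ?_).trans (natCast_mul_exp_le hd h2n hδ hδ1)
      rw [← hexp16]
      exact measureReal_many_points_le _ hk1 (two_le_scaled_deviation hd h2n hk1 hδ hδ1) hΔk i
    · simp only [hB₃, h2n, false_and]
      simpa using by positivity
  have e₄ : (sampleMeasure f n).real B₄ ≤ δ / 4 := by
    by_cases h2n : 2 ≤ n ∧ k ≤ n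
    · refine le_trans (measureReal_mono (fun x hx => hx.2.2)) <|
        (measureReal_not_hitsHalfBalls_le hd hf ?_).trans (net_mul_exp_le hd h2n.1
          (dimension_le_of_sampleSize hd h2n.1 h2n.2 hδ hδ1 hε hε1 hk) hδ hδ1)
      have h1 := (dimension_mul_log_bounds hd h2n.1).1
      have h2 := log_two_lt_log_two_div hδ hδ1
      have h3 : 0 < (d : ℝ) * Real.log n := by linarith
      have h4 : 0 < L := by linarith
      unfold hitMass
      positivity
    · have : B₄ = ∅ := Set.eq_empty_iff_forall_notMem.2 fun x hx => h2n ⟨hx.1, hx.2.1⟩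
      rw [this, measureReal_empty]; positivity
  have h := (measureReal_mono (μ := sampleMeasure f n) hsub).trans (measureReal_union_le _ _)
  have h' := measureReal_union_le (μ := sampleMeasure f n) B₂ (B₃ ∪ B₄)
  have h'' := measureReal_union_le (μ := sampleMeasure f n) B₃ B₄
  linarith

/-- The typical samples are not shown to be measurable; the complement of a measurable hull of the
bad ones replaces them. -/
theorem exists_measurableSet_subset_of_measureReal_compl_le {Ω : Type*} [MeasurableSpace Ω]
    (μ : Measure Ω) [IsProbabilityMeasure μ] (G : Set Ω) {δ : ℝ} (hδ : 0 ≤ δ)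
    (h : μ.real Gᶜ ≤ δ) :
    ∃ E ⊆ G, MeasurableSet E ∧ ENNReal.ofReal (1 - δ) ≤ μ E := by
  refine ⟨(toMeasurable μ Gᶜ)ᶜ, ?_, (measurableSet_toMeasurable _ _).compl, ?_⟩
  · exact Set.compl_subset_comm.1 (subset_toMeasurable μ Gᶜ)
  · rw [prob_compl_eq_one_sub (measurableSet_toMeasurable _ _), measure_toMeasurable,
      ENNReal.ofReal_sub _ hδ, ENNReal.ofReal_one]
    exact tsub_le_tsub_left ((ENNReal.le_ofReal_iff_toReal_le (measure_ne_top _ _) hδ).2 h) _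

/-! ### Nearest neighbour radii, nodes and level radii -/

section Graph

variable {d n : ℕ}

/-- The infimum is attained because the finitely many distances skip some interval just above `ρ`.
At `ρ = ⊤` the equivalence would fail for `n < k`. -/
theorem knnRadius_le_iff (k : ℕ) (x : Fin n → Space d) (i : Fin n) {ρ : ℝ≥0∞} (hρ : ρ ≠ ⊤) :
    knnRadius k x i ≤ ρ ↔ k ≤ {j | edist (x j) (x i) ≤ ρ}.ncard := by
  classical
  refine ⟨fun h => ?_, fun h => sInf_le h⟩
  by_contra hcon
  have hev : ∀ᶠ r in nhdsWithin ρ (Set.Ioi ρ), ∀ j, edist (x j) (x i) ≤ r →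
      edist (x j) (x i) ≤ ρ := by
    refine Filter.eventually_all.2 fun j => ?_
    rcases le_or_gt (edist (x j) (x i)) ρ with hj | hj
    · exact Filter.Eventually.of_forall fun _ _ => hj
    · filter_upwards [nhdsWithin_le_nhds (Iio_mem_nhds hj)] with r hr hle
      exact absurd hr (not_lt.2 hle)
  have hne : (nhdsWithin ρ (Set.Ioi ρ)).NeBot := nhdsGT_neBot_of_exists_gt ⟨⊤, hρ.lt_top⟩
  obtain ⟨r, hr, hlt⟩ := (hev.and self_mem_nhdsWithin).exists
  obtain ⟨r', hr', hlt'⟩ := sInf_lt_iff.1 (lt_of_le_of_lt h (Set.mem_Ioi.1 hlt))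
  refine hcon (le_trans hr' (Set.ncard_le_ncard fun j hj => hr j ?_))
  exact le_trans hj hlt'.le

theorem mem_nodes_ofReal_iff {k : ℕ} {x : Fin n → Space d} {i : Fin n} {R : ℝ} (hR : 0 ≤ R) :
    i ∈ nodes k x (ENNReal.ofReal R) ↔ k ≤ {j | dist (x j) (x i) ≤ R}.ncard := by
  simp_rw [nodes, Set.mem_ofPred_eq, knnRadius_le_iff k x i ENNReal.ofReal_ne_top,
    edist_le_ofReal hR]

theorem edgeScale_mono (alg : Algorithm) (k : ℕ) (x : Fin n → Space d) {r r' : ℝ≥0∞}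
    (h : r ≤ r') (i j : Fin n) : edgeScale alg k x r i j ≤ edgeScale alg k x r' i j := by
  cases alg
  · exact h
  · exact le_rfl
  · exact le_rfl

theorem edgeScale_le (alg : Algorithm) (k : ℕ) (x : Fin n → Space d) {r : ℝ≥0∞} {i j : Fin n}
    (hi : i ∈ nodes k x r) (hj : j ∈ nodes k x r) : edgeScale alg k x r i j ≤ r := by
  cases alg
  · exact le_rfl
  · exact min_le_of_left_le hi
  · exact max_le hi hj

theorem levelGraph_mono (alg : Algorithm) (α : ℝ) (k : ℕ) (x : Fin n → Space d) {r r' : ℝ≥0∞}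
    (h : r ≤ r') : levelGraph alg α k x r ≤ levelGraph alg α k x r' := by
  rintro i j ⟨hne, hi, hj, hd⟩
  refine ⟨hne, le_trans hi h, le_trans hj h, hd.trans ?_⟩
  gcongr
  exact edgeScale_mono alg k x h i j

theorem levelGraph_le_prunedGraph (alg : Algorithm) (α : ℝ) (k : ℕ) (Cδ ε' : ℝ)
    (x : Fin n → Space d) (r : ℝ≥0∞) :
    levelGraph alg α k x r ≤ prunedGraph alg α k Cδ ε' x r :=
  fun _ _ h => ⟨h.1, h.2.1, h.2.2.1, Or.inl h⟩

theorem dist_le_of_levelGraph_adj {alg : Algorithm} {α : ℝ} (hα : α ≤ 2) {k : ℕ}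
    {x : Fin n → Space d} {R : ℝ} (hR : 0 ≤ R) {i j : Fin n}
    (h : (levelGraph alg α k x (ENNReal.ofReal R)).Adj i j) : dist (x i) (x j) ≤ 2 * R := by
  obtain ⟨-, hi, hj, he⟩ := h
  rw [← edist_le_ofReal (by positivity), ENNReal.ofReal_mul (by norm_num)]
  refine he.trans ?_
  gcongr
  exact edgeScale_le alg k x hi hj

theorem mem_buffer_iff {Z : Set (Space d)} {σ : ℝ} {z : Space d} :
    z ∈ buffer Z σ ↔ ∃ a ∈ Z, dist z a ≤ σ := by
  rw [buffer, Set.mem_add]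
  constructor
  · rintro ⟨a, ha, b, hb, rfl⟩
    exact ⟨a, ha, by simpa [dist_eq_norm] using hb⟩
  · rintro ⟨a, ha, hz⟩
    exact ⟨a, ha, z - a, by simpa [dist_eq_norm] using hz, by simp⟩

theorem levelRadius_antitone (Cδ : ℝ) (d n k : ℕ) : Antitone (levelRadius Cδ d n k) := by
  intro a b hab
  unfold levelRadius
  have := unitBallVolume_pos d
  gcongr

theorem exists_pow_mul_eq (hd : 1 ≤ d) {a b : ℝ} (ha : 0 < a) (hb : 0 < b) :
    0 < (a / (unitBallVolume d * b)) ^ (1 / d : ℝ) ∧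
      unitBallVolume d * ((a / (unitBallVolume d * b)) ^ (1 / d : ℝ)) ^ d * b = a := by
  have hv := unitBallVolume_pos d
  refine ⟨by positivity, ?_⟩
  rw [one_div, Real.rpow_inv_natCast_pow (by positivity) (by omega)]
  field_simp

theorem exists_levelRadius_eq {k : ℕ} (hd : 1 ≤ d) {Cδ lam : ℝ} (hlam : 0 < lam)
    (hpos : 0 < (k : ℝ) / n + deviation Cδ d n k) :
    ∃ R : ℝ, 0 < R ∧ levelRadius Cδ d n k lam = ENNReal.ofReal R ∧
      unitBallVolume d * R ^ d * lam = k / n + deviation Cδ d n k := by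
  have hv := unitBallVolume_pos d
  obtain ⟨h1, h2⟩ := exists_pow_mul_eq hd hpos hlam
  refine ⟨_, h1, ?_, h2⟩
  rw [levelRadius, ← ENNReal.ofReal_div_of_pos (by positivity),
    ENNReal.ofReal_rpow_of_pos (by positivity)]

theorem reachable_of_adj_imp_reachable {V : Type*} {G H : SimpleGraph V}
    (h : ∀ u v, G.Adj u v → H.Reachable u v) {u v : V} (huv : G.Reachable u v) :
    H.Reachable u v := by
  obtain ⟨w⟩ := huv
  induction w with
  | nil => exact SimpleGraph.Reachable.refl _
  | cons hadj _ ih => exact (h _ _ hadj).trans ih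

/-! ### Chains of data points along a path -/

/-- Continuous induction on the parameters `t` at which some vertex reachable from `i` lies within
`s` of `γ t`: this set is closed and can always be extended to the right. -/
theorem reachable_of_joinedIn (G : SimpleGraph (Fin n)) (x : Fin n → Space d) {s : ℝ}
    (hs : 0 < s) {A : Set (Space d)} {i j : Fin n} (hij : JoinedIn A (x i) (x j))
    (hit : ∀ y ∈ A, ∀ b, dist b y ≤ s → ∃ l, dist (x l) y ≤ s ∧ dist (x l) b ≤ √2 * s)
    (hG : ∀ l m, l ≠ m → (∃ y ∈ A, dist (x l) y ≤ s) → (∃ y ∈ A, dist (x m) y ≤ s) →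
      dist (x l) (x m) ≤ √2 * s → G.Adj l m) :
    G.Reachable i j := by
  have hr1 : 1 ≤ √2 := Real.one_le_sqrt.2 (by norm_num)
  obtain ⟨γ, hγ⟩ := hij
  set S : Set unitInterval := {t | ∃ g, G.Reachable i g ∧ dist (x g) (γ t) ≤ s} with hS
  have hstep : ∀ g l t t', G.Reachable i g → dist (x g) (γ t) ≤ s → dist (x l) (γ t') ≤ s →
      dist (x l) (x g) ≤ √2 * s → G.Reachable i l := by
    intro g l t t' hg hgt hlt hlg
    by_cases hne : g = l
    · exact hne ▸ hg
    · refine hg.trans (hG g l hne ⟨_, hγ t, hgt⟩ ⟨_, hγ t', hlt⟩ ?_).reachable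
      rwa [dist_comm]
  have hclosed : IsClosed S := by
    have : S = ⋃ g ∈ {g | G.Reachable i g}, {t | dist (x g) (γ t) ≤ s} := by
      ext t; simp [hS]
    rw [this]
    exact (Set.toFinite _).isClosed_biUnion fun g _ => isClosed_le (by fun_prop) (by fun_prop)
  have h1 : (1 : unitInterval) ∈ S := by
    refine IsClosed.mem_of_ge_of_forall_exists_gt (a := 0) (hclosed.inter isClosed_Icc)
      ⟨i, SimpleGraph.Reachable.refl _, by simpa using hs.le⟩ zero_le_one ?_
    rintro t ⟨⟨g, hg, hgt⟩, -, ht1⟩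
    -- Only finitely many distances occur, so for `t'` near `t` the small excess over `√2 * s` can
    -- be dropped.
    have hev : ∀ᶠ t' in nhds t, ∀ l, dist (x l) (x g) ≤ √2 * s + dist (γ t') (γ t) →
        dist (x l) (x g) ≤ √2 * s := by
      refine Filter.eventually_all.2 fun l => ?_
      rcases le_or_gt (dist (x l) (x g)) (√2 * s) with h | h
      · exact Filter.Eventually.of_forall fun _ _ => h
      · have hc : Continuous fun t' => √2 * s + dist (γ t') (γ t) := by fun_prop
        have := hc.continuousAt.eventually_lt (continuousAt_const (y := dist (x l) (x g)))
          (x₀ := t) (by simpa using h)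
        filter_upwards [this] with t' h1 h2
        exact absurd h1 (not_lt.2 h2)
    have hne : (nhdsWithin t (Set.Ioi t)).NeBot := nhdsGT_neBot_of_exists_gt ⟨1, ht1⟩
    obtain ⟨t', ht', htt'⟩ :=
      ((hev.filter_mono (nhdsWithin_le_nhds (s := Set.Ioi t))).and self_mem_nhdsWithin).exists
    -- Translating `x g` with the path keeps it within `s` of the new path point.
    obtain ⟨l, hl1, hl2⟩ := hit (γ t') (hγ t') (x g + (γ t' - γ t)) (by
      rw [dist_eq_norm, show x g + (γ t' - γ t) - γ t' = x g - γ t by abel, ← dist_eq_norm]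
      exact hgt)
    have hlg : dist (x l) (x g) ≤ √2 * s := by
      refine ht' l ((dist_triangle _ (x g + (γ t' - γ t)) _).trans ?_)
      rw [dist_eq_norm (x g + _), add_sub_cancel_left, ← dist_eq_norm]
      linarith
    exact ⟨t', ⟨l, hstep g l t t' hg hgt hl1 hlg, hl1⟩, htt', unitInterval.le_one t'⟩
  obtain ⟨g, hg, hgt⟩ := h1
  refine hstep g j 1 1 hg hgt (by simpa using hs.le) ?_
  rw [Path.target] at hgt
  rw [dist_comm]
  nlinarith

/-- A chain in the level graph gives a path that stays close to the nodes. -/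
theorem joinedIn_of_reachable_levelGraph {alg : Algorithm} {α : ℝ} (hα : α ≤ 2) {k : ℕ}
    {x : Fin n → Space d} {R : ℝ} (hR : 0 ≤ R) {X : Set (Space d)} (hX : ∀ i, x i ∈ X)
    {i j : Fin n} (hi : i ∈ nodes k x (ENNReal.ofReal R))
    (h : (levelGraph alg α k x (ENNReal.ofReal R)).Reachable i j) :
    JoinedIn {z | z ∈ convexHull ℝ X ∧
      ∃ m ∈ nodes k x (ENNReal.ofReal R), dist z (x m) ≤ R} (x i) (x j) := by
  obtain ⟨w⟩ := h
  induction w with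
  | nil => exact JoinedIn.refl ⟨subset_convexHull ℝ X (hX _), _, hi, by simpa using hR⟩
  | @cons u v w hadj _ ih =>
    refine JoinedIn.trans (JoinedIn.of_segment_subset fun z hz => ?_) (ih hadj.2.2.1)
    refine ⟨(convex_convexHull ℝ X).segment_subset (subset_convexHull ℝ X (hX u))
      (subset_convexHull ℝ X (hX v)) hz, ?_⟩
    have h1 := dist_add_dist_of_mem_segment hz
    have h2 := dist_le_of_levelGraph_adj hα hR hadj
    rcases le_total (dist (x u) z) R with h3 | h3
    · exact ⟨u, hadj.2.1, by rwa [dist_comm]⟩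
    · exact ⟨v, hadj.2.2.1, by linarith⟩

end Graph

/-! ### Connectedness of the data points of a high-density set -/

section Typical

variable {d n k : ℕ} {X : Set (Space d)} {f : Space d → ℝ} {L σ lam R : ℝ}
  {x : Fin n → Space d} {A : Set (Space d)}

theorem IsTypicalSample.mem_nodes (hf : IsDensityOn X f) (hx : IsTypicalSample f L k x)
    (hlam : 0 < lam) (hR : 0 < R) (hA : ∀ z ∈ buffer A σ, lam ≤ f z) (hRσ : 2 * R ≤ σ)
    (hRlam : unitBallVolume d * R ^ d * lam = k / n + deviation (20 * L) d n k) {i : Fin n}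
    {y : Space d} (hy : y ∈ A) (hi : dist (x i) y ≤ R) : i ∈ nodes k x (ENNReal.ofReal R) := by
  rw [mem_nodes_ofReal_iff hR.le]
  refine hx.le_ncard i R ?_
  rw [← hRlam, ← volumeReal_closedBall (x i) hR.le, mul_comm]
  refine le_densityMeasure_real hf Metric.isClosed_closedBall.measurableSet (fun z hz => ?_) hlam.le
  refine hA z (mem_buffer_iff.2 ⟨y, hy, ?_⟩)
  linarith [dist_triangle z (x i) y, Metric.mem_closedBall.1 hz]

/-- Below radius `s` a density bounded by `M` does not provide the mass for `k` points. For
Algorithm 2 this bounds the edge scale from below. -/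
theorem IsTypicalSample.ofReal_le_knnRadius (hx : IsTypicalSample f L k x) (hn : 2 ≤ n)
    {M s : ℝ} (hM0 : 0 ≤ M) (hM : ∀ z, f z ≤ M) (hs : 0 ≤ s)
    (hsM : unitBallVolume d * s ^ d * M = k / n - deviation (20 * L) d n k) (i : Fin n) :
    ENNReal.ofReal s ≤ knnRadius k x i := by
  by_contra hcon
  have hlt := not_le.1 hcon
  have hne : knnRadius k x i ≠ ⊤ := hlt.ne_top
  set ρ := (knnRadius k x i).toReal with hρ
  have hρs : ρ ≤ s := ENNReal.toReal_le_of_le_ofReal hs hlt.le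
  have hρ0 : 0 ≤ ρ := ENNReal.toReal_nonneg
  have hmem : i ∈ nodes k x (ENNReal.ofReal ρ) := by
    rw [hρ, ENNReal.ofReal_toReal hne]
    exact le_refl (knnRadius k x i)
  rw [mem_nodes_ofReal_iff hρ0] at hmem
  refine absurd (hx.ncard_lt hn i ρ ?_) (not_lt.2 hmem)
  have hv := unitBallVolume_pos d
  refine (densityMeasure_real_le Metric.isClosed_closedBall.measurableSet
    measure_closedBall_lt_top.ne (fun z _ => hM z) hM0).trans ?_
  rw [volumeReal_closedBall _ hρ0, ← hsM, mul_comm]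
  gcongr

theorem IsTypicalSample.reachable (hd : 1 ≤ d) (hn : 2 ≤ n) (hk1 : 1 ≤ k)
    (hf : IsDensityOn X f) (hL : 0 < L) (hx : IsTypicalSample f L k x)
    (hdev0 : 0 ≤ deviation (20 * L) d n k) (hdev : deviation (20 * L) d n k ≤ 1 / 5 * (k / n))
    (hkL : 400 * (d * Real.log n * L) ≤ k) (alg : Algorithm) {α : ℝ} (hα : √2 ≤ α)
    (hlam : 0 < lam) (hR : 0 < R) (hA : ∀ z ∈ buffer A σ, lam ≤ f z) (hRσ : 2 * R ≤ σ)
    (hRlam : unitBallVolume d * R ^ d * lam = k / n + deviation (20 * L) d n k)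
    (hM : alg ≠ .linkage → ∃ M, (∀ z, f z ≤ M) ∧ M * (5000 * (d * Real.log n * L) / k) ≤ lam)
    {i j : Fin n} (hij : JoinedIn A (x i) (x j)) :
    (levelGraph alg α k x (ENNReal.ofReal R)).Reachable i j := by
  have hv := unitBallVolume_pos d
  have hn0 : (0 : ℝ) < n := by positivity
  have hk0 : (0 : ℝ) < k := by exact_mod_cast hk1
  have hD : 0 < d * Real.log n := by linarith [(dimension_mul_log_bounds hd hn).1]
  have hσ : 0 < σ := by linarith
  have hnode : ∀ l, ∀ y ∈ A, dist (x l) y ≤ R → l ∈ nodes k x (ENNReal.ofReal R) :=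
    fun l y hy hl => hx.mem_nodes hf hlam hR hA hRσ hRlam hy hl
  have hkn : k ≤ n := by
    have h1 := hnode i (x i) hij.source_mem (by simpa using hR.le)
    rw [mem_nodes_ofReal_iff hR.le] at h1
    refine h1.trans ((Set.ncard_le_card _).trans_eq ?_)
    simp
  -- The step length of the chain: `R` itself for Algorithm 1, the lower bound on nearest neighbour
  -- radii for Algorithm 2. There the second term of the threshold keeps half-balls of radius `s`
  -- heavy enough.
  obtain ⟨s, hs0, hsR, hsq, hedge⟩ : ∃ s : ℝ, 0 < s ∧ s ≤ R ∧
      hitMass d n L ≤ unitBallVolume d * s ^ d * lam ∧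
      ∀ l m, ENNReal.ofReal s ≤ edgeScale alg k x (ENNReal.ofReal R) l m := by
    by_cases halg : alg = .linkage
    · subst halg
      refine ⟨R, hR, le_rfl, ?_, fun _ _ => le_rfl⟩
      rw [hRlam, hitMass]
      have : 400 * (d * Real.log n * L) / n ≤ k / n := by gcongr
      linarith
    · obtain ⟨M, hfM, hMlam⟩ := hM halg
      have hlM : lam ≤ M := (hA (x i) (mem_buffer_iff.2
        ⟨x i, hij.source_mem, by simpa using hσ.le⟩)).trans (hfM _)
      have hM0 : 0 < M := hlam.trans_le hlM
      have hPd : 0 < (k : ℝ) / n - deviation (20 * L) d n k := by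
        have : 0 < (k : ℝ) / n := by positivity
        linarith
      obtain ⟨hs0, hsM⟩ := exists_pow_mul_eq (d := d) hd hPd hM0
      set s := (((k : ℝ) / n - deviation (20 * L) d n k) / (unitBallVolume d * M)) ^ (1 / d : ℝ)
      have hknn := hx.ofReal_le_knnRadius hn hM0.le hfM hs0.le hsM
      refine ⟨s, hs0, ?_, ?_, ?_⟩
      · refine le_of_pow_le_pow_left₀ (n := d) (by omega) hR.le ?_
        refine le_of_mul_le_mul_left (a := unitBallVolume d * lam) ?_ (by positivity)
        calc unitBallVolume d * lam * s ^ d = unitBallVolume d * s ^ d * lam := by ring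
          _ ≤ unitBallVolume d * s ^ d * M := by gcongr
          _ ≤ unitBallVolume d * R ^ d * lam := by rw [hsM, hRlam]; linarith
          _ = _ := by ring
      · calc hitMass d n L = 5000 * (d * Real.log n * L) / k * (2 / 25 * (k / n)) := by
              rw [hitMass]; field_simp; ring
          _ ≤ 5000 * (d * Real.log n * L) / k * (k / n - deviation (20 * L) d n k) := by
              gcongr
              have : 0 < (k : ℝ) / n := by positivity
              linarith
          _ = unitBallVolume d * s ^ d * (M * (5000 * (d * Real.log n * L) / k)) := by
              rw [← hsM]; ring
          _ ≤ _ := by gcongr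
      · intro l m
        cases alg
        · exact absurd rfl halg
        · exact le_min (hknn l) (hknn m)
        · exact (hknn l).trans (le_max_left _ _)
  refine reachable_of_joinedIn _ x hs0 hij (fun y hy b hb => ?_) ?_
  · refine hx.hitsHalfBalls hn hkn s hs0 y b hb fun z hz => ?_
    rw [div_le_iff₀ (by positivity)]
    have h1 : lam ≤ f z := hA z (mem_buffer_iff.2 ⟨y, hy, by
      linarith [Metric.mem_closedBall.1 hz]⟩)
    calc hitMass d n L ≤ unitBallVolume d * s ^ d * lam := hsq
      _ ≤ unitBallVolume d * s ^ d * f z := by gcongr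
      _ = _ := mul_comm _ _
  · rintro l m hne ⟨y, hy, hl⟩ ⟨y', hy', hm⟩ hdist
    refine ⟨hne, hnode l y hy (hl.trans hsR), hnode m y' hy' (hm.trans hsR), ?_⟩
    have hα0 : 0 ≤ α := (Real.sqrt_nonneg _).trans hα
    calc edist (x l) (x m) ≤ ENNReal.ofReal (α * s) := by
          rw [edist_le_ofReal (by positivity)]
          exact hdist.trans (by gcongr)
      _ = ENNReal.ofReal α * ENNReal.ofReal s := ENNReal.ofReal_mul hα0
      _ ≤ _ := by gcongr; exact hedge l m

end Typical

/-! ### The density threshold -/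

section Threshold

variable {d n k : ℕ} {X : Set (Space d)} {f : Space d → ℝ} {C δ ε ε' σ lam : ℝ}

theorem base_le_of_densityThreshold_le {alg : Algorithm}
    (h : densityThreshold alg X f C δ ε ε' σ n k ≤ (lam : EReal)) :
    k / (n * unitBallVolume d * (σ / 2) ^ d) * ((1 + ε) / (1 - ε)) + ε' / (1 - ε) ≤ lam := by
  cases alg
  · exact EReal.coe_le_coe_iff.1 h
  · exact EReal.coe_le_coe_iff.1 ((le_max_left _ _).trans h)
  · exact EReal.coe_le_coe_iff.1 ((le_max_left _ _).trans h)

/-- In this form the threshold leaves room to lower `lam` to `(1 - ε) * lam - ε'` or to `lam - ε' /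
2` and still have a level radius of at most `σ / 2`. -/
theorem threshold_mul_le {alg : Algorithm} (hε1 : ε < 1)
    (h : densityThreshold alg X f C δ ε ε' σ n k ≤ (lam : EReal)) :
    k / (n * unitBallVolume d * (σ / 2) ^ d) * (1 + ε) + ε' ≤ (1 - ε) * lam := by
  have h1 := base_le_of_densityThreshold_le h
  have h2 : 0 < 1 - ε := by linarith
  calc _ = (1 - ε) * (k / (n * unitBallVolume d * (σ / 2) ^ d) * ((1 + ε) / (1 - ε)) +
        ε' / (1 - ε)) := by
        generalize (k : ℝ) / (n * unitBallVolume d * (σ / 2) ^ d) = a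
        field_simp
    _ ≤ _ := by gcongr

/-- If `f` is unbounded on `X` the threshold is `⊤`, which no real `lam` attains. A point of
positive density excludes `⊥` and makes the bound valid outside `X` too. -/
theorem exists_bound_of_densityThreshold_le {alg : Algorithm} (hf : IsDensityOn X f)
    (halg : alg ≠ .linkage) (hc : 0 < C * d * Real.log n * Real.log (2 / δ) / k)
    (hX : ∃ z ∈ X, 0 < f z)
    (h : densityThreshold alg X f C δ ε ε' σ n k ≤ (lam : EReal)) :
    ∃ M, (∀ z, f z ≤ M) ∧ M * (C * d * Real.log n * Real.log (2 / δ) / k) ≤ lam := by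
  have h1 : supOn f X * ((C * d * Real.log n * Real.log (2 / δ) / k : ℝ) : EReal) ≤ lam := by
    cases alg
    · exact absurd rfl halg
    · exact (le_max_right _ _).trans h
    · exact (le_max_right _ _).trans h
  obtain ⟨z₀, hz₀, hfz₀⟩ := hX
  have hle : ∀ z ∈ X, (f z : EReal) ≤ supOn f X := fun z hz =>
    le_iSup₂ (f := fun z (_ : z ∈ X) => (f z : EReal)) z hz
  have htop : supOn f X ≠ ⊤ := by
    intro htop
    rw [htop, EReal.top_mul_coe_of_pos hc] at h1
    exact EReal.coe_ne_top _ (top_le_iff.1 h1)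
  have hbot : supOn f X ≠ ⊥ := fun hbot => by
    have := hle z₀ hz₀
    rw [hbot] at this
    exact EReal.coe_ne_bot _ (le_bot_iff.1 this)
  obtain ⟨M, hM⟩ : ∃ M : ℝ, supOn f X = M := ⟨_, (EReal.coe_toReal htop hbot).symm⟩
  rw [hM] at hle h1
  have hle' : ∀ z ∈ X, f z ≤ M := fun z hz => EReal.coe_le_coe_iff.1 (hle z hz)
  refine ⟨M, fun z => ?_, by exact_mod_cast h1⟩
  by_cases hz : z ∈ X
  · exact hle' z hz
  · rw [hf.eq_zero_of_notMem z hz]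
    exact hfz₀.le.trans (hle' z₀ hz₀)

theorem two_mul_le_of_level (hd : 1 ≤ d) (hn : 1 ≤ n) {e R : ℝ} (hε : 0 < ε)
    (he : e ≤ ε / 5 * (k / n)) (hσ : 0 < σ) (hlam : 0 < lam)
    (hR : unitBallVolume d * R ^ d * lam = k / n + e)
    (h : k / (n * unitBallVolume d * (σ / 2) ^ d) * (1 + ε) ≤ lam) : 2 * R ≤ σ := by
  have hv := unitBallVolume_pos d
  have hn0 : (0 : ℝ) < n := by exact_mod_cast hn
  have h1 : R ≤ σ / 2 := by
    refine le_of_pow_le_pow_left₀ (n := d) (by omega) (by positivity) ?_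
    refine le_of_mul_le_mul_left (a := unitBallVolume d * lam) ?_ (by positivity)
    have hP : 0 ≤ (k : ℝ) / n := by positivity
    calc unitBallVolume d * lam * R ^ d = k / n + e := by rw [← hR]; ring
      _ ≤ k / n * (1 + ε) := by nlinarith
      _ = unitBallVolume d * (σ / 2) ^ d *
          (k / (n * unitBallVolume d * (σ / 2) ^ d) * (1 + ε)) := by field_simp
      _ ≤ unitBallVolume d * (σ / 2) ^ d * lam := by gcongr
      _ = _ := by ring
  linarith

end Threshold

/-! ### Recovery of true clusters -/

section Recovery

variable {d n k : ℕ} {X : Set (Space d)} {f : Space d → ℝ} {L ε ε' σ lam : ℝ}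
  {x : Fin n → Space d}

theorem IsDensityOn.le_of_mem_buffer (hf : IsDensityOn X f) {B Z : Set (Space d)}
    (hlam : lam = sInf (f '' B)) (hZ : Z ⊆ B) : ∀ z ∈ Z, lam ≤ f z := by
  intro z hz
  rw [hlam]
  refine csInf_le ⟨0, ?_⟩ ⟨z, hZ hz, rfl⟩
  rintro _ ⟨y, -, rfl⟩
  exact hf.nonneg y

theorem IsTypicalSample.mem (hf : IsDensityOn X f) (hx : IsTypicalSample f L k x) (i : Fin n) :
    x i ∈ X := by
  by_contra h
  exact (hx.pos i).ne' (hf.eq_zero_of_notMem _ h)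

/-- At a level where all points near `S` have too little density, no component of the level
graph joins two data points separated by `S`. -/
theorem IsTypicalSample.not_reachable (hf : IsDensityOn X f) (hx : IsTypicalSample f L k x)
    (hn : 2 ≤ n) (alg : Algorithm) {α : ℝ} (hα : α ≤ 2) {A A' S : Set (Space d)}
    (hS : Separates (convexHull ℝ X) S A A') {R u : ℝ} (hR : 0 < R) (hRσ : 2 * R ≤ σ)
    (hu : ∀ z ∈ buffer S σ, f z ≤ u)
    (hmass : u * (unitBallVolume d * R ^ d) ≤ k / n - deviation (20 * L) d n k) {i j : Fin n}
    (hi : x i ∈ A) (hj : x j ∈ A') (hin : i ∈ nodes k x (ENNReal.ofReal R)) :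
    ¬ (levelGraph alg α k x (ENNReal.ofReal R)).Reachable i j := by
  intro h
  obtain ⟨γ, hγ⟩ := joinedIn_of_reachable_levelGraph hα hR.le (hx.mem hf) hin h
  obtain ⟨t, ht⟩ := hS _ hi _ hj γ fun t => (hγ t).1
  obtain ⟨-, m, hm, hdist⟩ := hγ t
  have hu' : ∀ z ∈ Metric.closedBall (x m) R, f z ≤ u := fun z hz => by
    refine hu z (mem_buffer_iff.2 ⟨_, ht, ?_⟩)
    linarith [dist_triangle_right z (γ t) (x m), Metric.mem_closedBall.1 hz]
  rw [mem_nodes_ofReal_iff hR.le] at hm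
  refine absurd (hx.ncard_lt hn m R ?_) (not_lt.2 hm)
  refine (densityMeasure_real_le Metric.isClosed_closedBall.measurableSet
    measure_closedBall_lt_top.ne hu' ?_).trans ?_
  · exact (hf.nonneg (x m)).trans (hu' _ (Metric.mem_closedBall_self hR.le))
  · rwa [volumeReal_closedBall _ hR.le]

/-- The density looked up when pruning the level of `lam` is not much smaller than `lam`. -/
theorem lookup_bounds {P e w : ℝ} (hP : 0 < P) (he0 : 0 ≤ e) (hε : 0 < ε) (hε1 : ε < 1)
    (he : e ≤ ε / 5 * P) (hε' : 0 < ε') (hlam : 0 < lam) (hw : w * lam = P + e) :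
    (1 - ε) * lam - ε' ≤ 1 / w * (P - e) - ε' ∧ 1 / w * (P - e) - ε' ≤ lam ∧
      ∀ w', 0 ≤ w' → w' * (1 / w * (P - e) - ε') = P + e →
        ((1 - 2 * ε) * lam - ε') * w' ≤ P - e := by
  -- The factor `ρ ≥ 1 - ε / 2` is lost twice, in passing from `lam` to the looked up density and
  -- from the mass defining that level to the mass a node must have; `ρ ^ 2 ≥ 1 - 2 * ε` covers
  -- both.
  set ρ := (P - e) / (P + e) with hρ
  have hPe : 0 < P + e := by linarith
  have hw0 : w ≠ 0 := by rintro rfl; linarith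
  have hwl : 1 / w * (P - e) = lam * ρ := by
    rw [hρ, ← hw]; field_simp
  have hεP : ε * P ≤ P := by nlinarith
  have hρ1 : ρ ≤ 1 := by rw [hρ, div_le_one hPe]; linarith
  have hρ2 : 1 - ε / 2 ≤ ρ := by rw [hρ, le_div_iff₀ hPe]; nlinarith [mul_nonneg he0 hε.le]
  rw [hwl]
  refine ⟨by nlinarith, by nlinarith, fun w' hw'0 hw' => ?_⟩
  calc ((1 - 2 * ε) * lam - ε') * w' ≤ ((lam * ρ - ε') * ρ) * w' := by
        gcongr
        have h1 : 1 - 2 * ε ≤ ρ ^ 2 := by nlinarith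
        nlinarith [mul_le_mul_of_nonneg_right h1 hlam.le]
    _ = w' * (lam * ρ - ε') * ρ := by ring
    _ = P - e := by rw [hw', hρ]; field_simp

end Recovery

/-! ### The two guarantees for a typical sample -/

section Guarantees

variable {d n k : ℕ} {X : Set (Space d)} {f : Space d → ℝ} {δ ε ε' α σ : ℝ}
  {x : Fin n → Space d}

theorem deviation_nonneg (d n k : ℕ) (hδ : 0 < δ) (hδ1 : δ < 1) :
    0 ≤ deviation (20 * Real.log (2 / δ)) d n k := by
  have := log_two_lt_log_two_div hδ hδ1
  unfold deviation
  positivity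

theorem deviation_le (hn : 1 ≤ n) (hε : 0 < ε)
    (hk : 10000 * (d * Real.log n / ε ^ 2) * Real.log (2 / δ) ^ 2 ≤ (k : ℝ)) :
    deviation (20 * Real.log (2 / δ)) d n k ≤ ε / 5 * (k / n) := by
  calc deviation (20 * Real.log (2 / δ)) d n k
      = 20 * Real.log (2 / δ) * √(k * d * Real.log n) / n := by rw [deviation]; ring
    _ ≤ ε / 5 * k / n :=
        div_le_div_of_nonneg_right (scaled_deviation_le hn hε hk) (Nat.cast_nonneg n)
    _ = _ := by ring

theorem hit_le_of_sampleSize (hd : 1 ≤ d) (hn : 2 ≤ n) (hδ : 0 < δ) (hδ1 : δ < 1) (hε : 0 < ε)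
    (hε1 : ε < 1)
    (hk : 10000 * (d * Real.log n / ε ^ 2) * Real.log (2 / δ) ^ 2 ≤ (k : ℝ)) :
    400 * (d * Real.log n * Real.log (2 / δ)) ≤ k := by
  have h1 := (dimension_mul_log_bounds hd hn).1
  have h2 := log_two_lt_log_two_div hδ hδ1
  have h3 := le_of_sampleSize hε hk
  have h4 : ε ^ 2 * k ≤ k := mul_le_of_le_one_left (Nat.cast_nonneg _) (by nlinarith)
  have h5 : 0 < d * Real.log n * Real.log (2 / δ) := by positivity
  nlinarith

/-- The constant `10000` is twice the `5000` needed for connectedness, so that the latter can also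
be used at a density reduced by up to a half, as in the removal of false clusters. -/
theorem exists_half_bound (hd : 1 ≤ d) (hn : 2 ≤ n) (hk1 : 1 ≤ k) (hf : IsDensityOn X f)
    (hδ : 0 < δ) (hδ1 : δ < 1) (hx : IsTypicalSample f (Real.log (2 / δ)) k x) (i : Fin n)
    {alg : Algorithm} {lam lam' : ℝ} (hlam : lam ≤ 2 * lam')
    (h : densityThreshold alg X f 10000 δ ε ε' σ n k ≤ (lam : EReal)) :
    alg ≠ .linkage → ∃ M, (∀ z, f z ≤ M) ∧
      M * (5000 * (d * Real.log n * Real.log (2 / δ)) / k) ≤ lam' := by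
  intro halg
  have h1 := (dimension_mul_log_bounds hd hn).2.2.1
  have h2 := log_two_lt_log_two_div hδ hδ1
  obtain ⟨M, hM, hMlam⟩ := exists_bound_of_densityThreshold_le hf halg (by
    have h3 : (0 : ℝ) < k := by exact_mod_cast hk1
    have h4 : (0 : ℝ) < d := by exact_mod_cast hd
    have h5 : 0 < Real.log n := by linarith
    positivity) ⟨x i, hx.mem hf i, hx.pos i⟩ h
  refine ⟨M, hM, ?_⟩
  have : M * (10000 * d * Real.log n * Real.log (2 / δ) / k) =
      2 * (M * (5000 * (d * Real.log n * Real.log (2 / δ)) / k)) := by ring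
  linarith

theorem IsTypicalSample.recoversTrueClusters (hd : 1 ≤ d) (hn : 1 ≤ n) (hk1 : 1 ≤ k)
    (hf : IsDensityOn X f) (hδ : 0 < δ) (hδ1 : δ < 1) (hε : 0 < ε) (hε1 : ε < 1) (hε' : 0 < ε')
    (hα : √2 ≤ α) (hα2 : α ≤ 2)
    (hk : 10000 * (d * Real.log n / ε ^ 2) * Real.log (2 / δ) ^ 2 ≤ (k : ℝ)) (alg : Algorithm)
    (hx : IsTypicalSample f (Real.log (2 / δ)) k x) (hσ : 0 < σ) :
    RecoversTrueClusters alg X f 10000 (20 * Real.log (2 / δ)) δ ε ε' α k σ x := by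
  rintro A A' lam hAX - hlam hthr ⟨S, hS, hSlt⟩
  have hv := unitBallVolume_pos d
  have hn0 : (0 : ℝ) < n := by exact_mod_cast hn
  have hk0 : (0 : ℝ) < k := by exact_mod_cast hk1
  have hP : 0 < (k : ℝ) / n := by positivity
  have he0 := deviation_nonneg d n k hδ hδ1
  have he := deviation_le (d := d) (n := n) (k := k) hn hε hk
  have he5 : deviation (20 * Real.log (2 / δ)) d n k ≤ 1 / 5 * (k / n) := by nlinarith
  have hL : 0 < Real.log (2 / δ) := by linarith [log_two_lt_log_two_div hδ hδ1]
  have hmul := threshold_mul_le hε1 hthr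
  have ha : 0 < k / (n * unitBallVolume d * (σ / 2) ^ d) * (1 + ε) := by positivity
  have hlam0 : 0 < lam := by
    by_contra h
    nlinarith [not_lt.1 h]
  obtain ⟨R, hR, hRlev, hRlam⟩ := exists_levelRadius_eq (k := k) hd hlam0
    (add_pos_of_pos_of_nonneg hP he0)
  have hRσ := two_mul_le_of_level hd hn hε he hσ hlam0 hRlam (by nlinarith)
  have hA := hf.le_of_mem_buffer hlam Set.subset_union_left
  have hA' := hf.le_of_mem_buffer hlam Set.subset_union_right
  rw [hRlev]
  have hnodes : ∀ {B : Set (Space d)}, (∀ z ∈ buffer B σ, lam ≤ f z) → ∀ l, x l ∈ B →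
      l ∈ nodes k x (ENNReal.ofReal R) := fun hB l hl =>
    hx.mem_nodes hf hlam0 hR hB hRσ hRlam hl (by simpa using hR.le)
  have hconn : ∀ {B : Set (Space d)}, (∀ z ∈ buffer B σ, lam ≤ f z) → IsPathConnected B →
      SampleConnected alg α k (20 * Real.log (2 / δ)) ε' x (ENNReal.ofReal R) B := by
    intro B hB hpc i j hi hj
    refine ⟨hnodes hB i hi, hnodes hB j hj, ?_⟩
    rcases hn.lt_or_eq with h2n | rfl
    · refine (hx.reachable hd h2n hk1 hf hL he0 he5 (hit_le_of_sampleSize hd h2n hδ hδ1 hε hε1 hk)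
        alg hα hlam0 hR hB hRσ hRlam (exists_half_bound hd h2n hk1 hf hδ hδ1 hx i (by linarith) hthr)
        (hpc.joinedIn _ hi _ hj)).mono (levelGraph_le_prunedGraph ..)
    · rw [Subsingleton.elim i j]
  refine ⟨hconn hA, hconn hA', ?_, ?_⟩
  · rintro i (hi | hi)
    · exact hnodes hA i hi
    · exact hnodes hA' i hi
  intro i j hi hj hreach
  have hu : ∀ z ∈ buffer S σ, f z < (1 - 2 * ε) * lam - ε' := fun z hz =>
    EReal.coe_lt_coe_iff.1 <| lt_of_le_of_lt
      (le_iSup₂ (f := fun z (_ : z ∈ buffer S σ) => (f z : EReal)) z hz) hSlt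
  rcases hn.lt_or_eq with h2n | rfl
  · obtain ⟨hlo, hhi, hmass⟩ := lookup_bounds hP he0 hε hε1 he hε' hlam0 hRlam
    set lt := 1 / (unitBallVolume d * R ^ d) *
      (k / n - deviation (20 * Real.log (2 / δ)) d n k) - ε' with hlt
    have hlt0 : 0 < lt := by linarith
    obtain ⟨R', hR', hRlev', hRlam'⟩ := exists_levelRadius_eq (k := k) hd hlt0
      (add_pos_of_pos_of_nonneg hP he0)
    have hRσ' := two_mul_le_of_level hd hn hε he hσ hlt0 hRlam' (by linarith)
    have hlook : lookupRadius (20 * Real.log (2 / δ)) ε' d n k (ENNReal.ofReal R) =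
        ENNReal.ofReal R' := by
      rw [lookupRadius, lookupDensity, ENNReal.toReal_ofReal hR.le, ← hlt, max_eq_left hlt0.le,
        hRlev']
    have hRR' : ENNReal.ofReal R ≤ ENNReal.ofReal R' := by
      rw [← hRlev, ← hRlev']
      exact levelRadius_antitone _ _ _ _ hhi
    refine hx.not_reachable hf h2n alg hα2 hS hR' hRσ' (fun z hz => (hu z hz).le)
      (hmass _ (by positivity) hRlam') hi hj (le_trans (hnodes hA i hi) hRR') ?_
    -- Both kinds of edges of the pruned graph stay inside components at the larger radius `R'`, so
    -- separation there is enough.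
    refine reachable_of_adj_imp_reachable ?_ hreach
    rintro l m ⟨-, -, -, hadj | hadj⟩
    · exact (levelGraph_mono alg α k x hRR' hadj).reachable
    · rwa [hlook] at hadj
  -- With a single data point the constant path must meet `S`, which makes the density there both
  -- small and at least `lam`.
  · obtain rfl := Subsingleton.elim i j
    obtain ⟨t, ht⟩ := hS _ hi _ hj (Path.refl _) fun t => subset_convexHull ℝ X (hAX hi)
    have h1 := hu (x i) (mem_buffer_iff.2 ⟨_, ht, by simpa using hσ.le⟩)
    have h2 := hA (x i) (mem_buffer_iff.2 ⟨_, hi, by simpa using hσ.le⟩)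
    nlinarith

/-! ### Removal of false clusters -/

theorem abs_sub_le_of_oscillation (h : 2 * oscillation f σ ≤ (ε' : EReal)) {z z' : Space d}
    (hz : dist z z' ≤ σ) : 2 * |f z - f z'| ≤ ε' := by
  have h1 : ((|f z - f z'| : ℝ) : EReal) ≤ oscillation f σ := by
    rw [dist_eq_norm] at hz
    exact le_iSup_of_le z (le_iSup_of_le z' (le_iSup_of_le hz le_rfl))
  have h2 : (2 : EReal) * ((|f z - f z'| : ℝ) : EReal) ≤ 2 * oscillation f σ := by gcongr
  rw [← EReal.coe_le_coe_iff, EReal.coe_mul]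
  exact h2.trans h

theorem IsPrunedCluster.mem_of_reachable {alg : Algorithm} {Cδ : ℝ} {r : ℝ≥0∞}
    {T : Set (Fin n)} (hT : IsPrunedCluster alg α k Cδ ε' x r T) {i j : Fin n} (hi : i ∈ T)
    (hj : j ∈ nodes k x r) (h : (prunedGraph alg α k Cδ ε' x r).Reachable i j) : j ∈ T := by
  obtain ⟨i₀, -, rfl⟩ := hT
  exact ⟨hj, hi.2.trans h⟩

theorem IsPrunedCluster.subset_nodes {alg : Algorithm} {Cδ : ℝ} {r : ℝ≥0∞}
    {T : Set (Fin n)} (hT : IsPrunedCluster alg α k Cδ ε' x r T) : T ⊆ nodes k x r := by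
  obtain ⟨i₀, -, rfl⟩ := hT
  exact fun _ h => h.1

/-- The density looked up when pruning a level is well below that of any node of this level. -/
theorem IsTypicalSample.lookupDensity_le (hn : 2 ≤ n) (hf : IsDensityOn X f)
    (hδ : 0 < δ) (hδ1 : δ < 1) (hε : 0 < ε) (hε' : 0 < ε')
    (hx : IsTypicalSample f (Real.log (2 / δ)) k x) (hσ : 0 < σ)
    (hosc : ∀ z z' : Space d, dist z z' ≤ σ → 2 * |f z - f z'| ≤ ε') {r : ℝ} (hr : 0 < r)
    {m : Fin n} (hm : m ∈ nodes k x (ENNReal.ofReal r))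
    (hmul : k / (n * unitBallVolume d * (σ / 2) ^ d) * (1 + ε) ≤ f (x m)) :
    lookupDensity (20 * Real.log (2 / δ)) ε' d n k (ENNReal.ofReal r) ≤ f (x m) - ε' / 2 := by
  have hv := unitBallVolume_pos d
  have hn0 : (0 : ℝ) < n := by positivity
  have he0 := deviation_nonneg d n k hδ hδ1
  rw [lookupDensity, ENNReal.toReal_ofReal hr.le]
  suffices h : 1 / (unitBallVolume d * r ^ d) *
      (k / n - deviation (20 * Real.log (2 / δ)) d n k) ≤ f (x m) + ε' / 2 by linarith
  rw [one_div_mul_eq_div, div_le_iff₀ (by positivity)]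
  -- For `r ≤ σ` the density on the whole `r`-ball is controlled by the oscillation, and being a
  -- node bounds its mass from below. For larger `r`, already `k / n` spread over such a ball has
  -- density below the threshold.
  rcases le_or_gt r σ with hrσ | hrσ
  · rw [mem_nodes_ofReal_iff hr.le] at hm
    have h1 := mt (hx.ncard_lt hn m r) (not_lt.2 hm)
    rw [← volumeReal_closedBall (x m) hr.le]
    refine (not_le.1 h1).le.trans (densityMeasure_real_le
      Metric.isClosed_closedBall.measurableSet measure_closedBall_lt_top.ne (fun z hz => ?_) ?_)
    · have h2 := hosc z (x m) ((Metric.mem_closedBall.1 hz).trans hrσ)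
      linarith [le_abs_self (f z - f (x m))]
    · linarith [hf.nonneg (x m)]
  · have h1 : 0 ≤ k / (n * unitBallVolume d * (σ / 2) ^ d) := by positivity
    calc k / n - deviation (20 * Real.log (2 / δ)) d n k ≤ k / n := by linarith
      _ = k / (n * unitBallVolume d * (σ / 2) ^ d) * (unitBallVolume d * (σ / 2) ^ d) := by
          field_simp
      _ ≤ (f (x m) + ε' / 2) * (unitBallVolume d * r ^ d) := by
          gcongr
          · linarith [hf.nonneg (x m)]
          · nlinarith
          · linarith

theorem IsTypicalSample.removesFalseClusters (hd : 1 ≤ d) (hk1 : 1 ≤ k)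
    (hf : IsDensityOn X f) (hδ : 0 < δ) (hδ1 : δ < 1) (hε : 0 < ε) (hε1 : ε < 1) (hε' : 0 < ε')
    (hα : √2 ≤ α)
    (hk : 10000 * (d * Real.log n / ε ^ 2) * Real.log (2 / δ) ^ 2 ≤ (k : ℝ)) (alg : Algorithm)
    (hx : IsTypicalSample f (Real.log (2 / δ)) k x) (hσ : 0 < σ) :
    RemovesFalseClusters alg X f 10000 (20 * Real.log (2 / δ)) δ ε ε' α k σ x := by
  intro hosc r T T' lam hr hT hT' hdisj hlam hthr i hi j hj hjoin
  have hosc' : ∀ z z' : Space d, dist z z' ≤ σ → 2 * |f z - f z'| ≤ ε' :=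
    fun z z' h => abs_sub_le_of_oscillation hosc h
  have hij : i ≠ j := fun h => Set.disjoint_left.1 hdisj hi (h ▸ hj)
  have hn : 2 ≤ n := by
    by_contra h
    have : Subsingleton (Fin n) := Fin.subsingleton_iff_le_one.2 (by omega)
    exact hij (Subsingleton.elim i j)
  have hv := unitBallVolume_pos d
  have hn0 : (0 : ℝ) < n := by positivity
  have hk0 : (0 : ℝ) < k := by exact_mod_cast hk1
  have hP : 0 < (k : ℝ) / n := by positivity
  have he0 := deviation_nonneg d n k hδ hδ1
  have he := deviation_le (d := d) (n := n) (k := k) (by omega) hε hk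
  have he5 : deviation (20 * Real.log (2 / δ)) d n k ≤ 1 / 5 * (k / n) := by nlinarith
  have hL : 0 < Real.log (2 / δ) := by linarith [log_two_lt_log_two_div hδ hδ1]
  have hmul := threshold_mul_le hε1 hthr
  have ha : 0 < k / (n * unitBallVolume d * (σ / 2) ^ d) * (1 + ε) := by positivity
  have hlam0 : 0 < lam := by
    by_contra h
    nlinarith [not_lt.1 h]
  -- The lookup estimate is sharpest at a node of least density, where it compares with `lam`
  -- itself.
  obtain ⟨m, hm, hmlam⟩ : ∃ m ∈ T ∪ T', f (x m) = lam := by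
    have : lam ∈ (fun i => f (x i)) '' (T ∪ T') := by
      rw [hlam]
      exact Set.Nonempty.csInf_mem ⟨_, i, Or.inl hi, rfl⟩ (Set.toFinite _)
    exact this
  have hmn : m ∈ nodes k x (ENNReal.ofReal r) := hm.elim (hT.subset_nodes ·) (hT'.subset_nodes ·)
  have hlook := hx.lookupDensity_le hn hf hδ hδ1 hε hε' hσ hosc' hr hmn
    (by rw [hmlam]; nlinarith)
  rw [hmlam] at hlook
  have hbound : k / (n * unitBallVolume d * (σ / 2) ^ d) * (1 + ε) ≤ lam - ε' / 2 := by nlinarith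
  have hlam' : 0 < lam - ε' / 2 := ha.trans_le hbound
  obtain ⟨R, hR, hRlev, hRlam⟩ := exists_levelRadius_eq (k := k) hd hlam'
    (add_pos_of_pos_of_nonneg hP he0)
  have hRσ := two_mul_le_of_level hd (by omega) hε he hσ hlam' hRlam hbound
  have hA : ∀ z ∈ buffer {y | y ∈ X ∧ lam ≤ f y} σ, lam - ε' / 2 ≤ f z := by
    intro z hz
    obtain ⟨y, hy, hzy⟩ := mem_buffer_iff.1 hz
    linarith [neg_abs_le (f z - f y), hosc' z y hzy, hy.2]
  have hreach := hx.reachable hd hn hk1 hf hL he0 he5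
    (hit_le_of_sampleSize hd hn hδ hδ1 hε hε1 hk) alg hα hlam' hR hA hRσ hRlam
    (exists_half_bound hd hn hk1 hf hδ hδ1 hx i (by nlinarith) hthr) hjoin
  have hle : ENNReal.ofReal R ≤
      lookupRadius (20 * Real.log (2 / δ)) ε' d n k (ENNReal.ofReal r) := by
    rw [← hRlev, lookupRadius]
    exact levelRadius_antitone _ _ _ _ (max_le hlook hlam'.le)
  have hadj : (prunedGraph alg α k (20 * Real.log (2 / δ)) ε' x (ENNReal.ofReal r)).Adj j i :=
    ⟨hij.symm, hT'.subset_nodes hj, hT.subset_nodes hi,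
      Or.inr (hreach.symm.mono (levelGraph_mono alg α k x hle))⟩
  exact Set.disjoint_left.1 hdisj hi
    (hT'.mem_of_reachable hj (hT.subset_nodes hi) hadj.reachable)

end Guarantees

end ClusterTree

end

theorem mainTheorem5 :
    ∃ C₀ : ℝ, 0 < C₀ ∧ ∃ C : ℝ, 0 < C ∧
      ∀ (d n k : ℕ) (X : Set (ClusterTree.Space d)) (f : ClusterTree.Space d → ℝ)
        (δ ε ε' α : ℝ) (alg : ClusterTree.Algorithm),
        1 ≤ d → 1 ≤ n → 1 ≤ k →
        ClusterTree.IsDensityOn X f →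
        0 < δ → δ < 1 → 0 < ε → ε < 1 → 0 < ε' →
        √2 ≤ α → α ≤ 2 →
        C * (d * Real.log n / ε ^ 2) * Real.log (2 / δ) ^ 2 ≤ (k : ℝ) →
        ∃ E : Set (Fin n → ClusterTree.Space d), MeasurableSet E ∧
          ENNReal.ofReal (1 - δ) ≤ ClusterTree.sampleMeasure f n E ∧
          ∀ x ∈ E, ∀ σ : ℝ, 0 < σ →
            ClusterTree.RecoversTrueClusters alg X f C (ClusterTree.confidenceConst C₀ δ)
              δ ε ε' α k σ x ∧
            ClusterTree.RemovesFalseClusters alg X f C (ClusterTree.confidenceConst C₀ δ)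
              δ ε ε' α k σ x := by
  -- `C₀ = 10` gives `C_δ = 20 * log (2 / δ)`, the deviation built into `IsTypicalSample`.
  refine ⟨10, by norm_num, 10000, by norm_num, ?_⟩
  intro d n k X f δ ε ε' α alg hd hn hk1 hf hδ hδ1 hε hε1 hε' hα hα2 hk
  have := hf.isProbabilityMeasure
  have : IsProbabilityMeasure (ClusterTree.sampleMeasure f n) := by
    unfold ClusterTree.sampleMeasure; infer_instance
  obtain ⟨E, hEG, hEm, hE⟩ := ClusterTree.exists_measurableSet_subset_of_measureReal_compl_le
    (ClusterTree.sampleMeasure f n)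
    {x | ClusterTree.IsTypicalSample f (Real.log (2 / δ)) k x} hδ.le
    (ClusterTree.sampleMeasure_not_isTypicalSample_le hd hn hk1 hf hδ hδ1 hε hε1 hk)
  have hC : ClusterTree.confidenceConst 10 δ = 20 * Real.log (2 / δ) := by
    rw [ClusterTree.confidenceConst]; norm_num
  rw [hC]
  exact ⟨E, hEm, hE, fun x hx σ hσ =>
    ⟨(hEG hx).recoversTrueClusters hd hn hk1 hf hδ hδ1 hε hε1 hε' hα hα2 hk alg hσ,
      (hEG hx).removesFalseClusters hd hk1 hf hδ hδ1 hε hε1 hε' hα hk alg hσ⟩⟩
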